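/- Let $[d]=\{1,\dots,d\}$. Definitions, in $\mathbb R^d$: * For $I\subseteq[d]$ and $\lambda:I\to\mathbb R$, the generalized hyperplane $\Pi_{I,\lambda}=\{x: x_i=\lambda_i \text{ for } i\in I\}$ has dimension $d-|I|$; it is identified with $\mathbb R^{d-|I|}$ by forgetting the coordinates in $I$. A pure $d$-dimensional orthogonal polytope is a finite union of boxes $\prod_{i=1}^d[a_i,b_i]$ with $a_i<b_i$ for all $i$. * A local orthotopal arrangement is a union of closed orthants $\{x:s_ix_i\ge 0 \text{ for all } i\}$, $s\in\{\pm1\}^d$. The tangent cone of $P$ at $v$ is the local orthotopal arrangement $\alpha$ such that $(P-v)\cap[-\delta,\delta]^d=\alpha\cap[-\delta,\delta]^d$ for some $\delta>0$. Two arrangements are congruent if a symmetry of the cube $[-1,1]^d$ carries one onto the other. * The genericity region of $v\in P$ is the set of points that can be joined to $v$ by a path in $P$ along which the tangent cone is everywhere congruent to the tangent cone at $v$. Its degree is the smallest dimension of a generalized hyperplane containing it. A $k$-dimensional face of $P$ is the closure of a genericity region of degree $k$, and $v$ is a singular point of $P$ if its genericity region has degree $0$. * A floral vertex in $\mathbb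 R^d$ is a set obtained from half-spaces $\{x:s_ix_i\ge 0\}$, $i\in[d]$, $s_i\in\{\pm1\}$, by finitely many (binary) unions and intersections in which every index $i\in[d]$ is used exactly once (for $d=0$ it is the one-point space $\mathbb R^0$). * A generic orthotope of dimension $d$ in $\mathbb R^d$ is a pure $d$-dimensional orthogonal polytope whose tangent cone at every singular point is a floral vertex. A subset of a $k$-dimensional generalized hyperplane is a generic orthotope of dimension $k$ if it is one under the identification of that hyperplane with $\mathbb R^k$. **Proposition.** Let $P\subset\mathbb R^d$ be a generic orthotope of dimension $d$. Then every $k$-dimensional face of $P$ is a generic orthotope of dimension $k$. -/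

import Mathlib

/-! Throughout, `ι` is a finite index set of coordinates and `ι → ℝ` is the Euclidean space with
these coordinates; `ℝ^d` is `Fin d → ℝ`. Signs are elements of `ℤˣ = {1, -1}`. -/

namespace Orthotope

variable {ι : Type*}

/-- The generalized hyperplane `Π_{I,l} = {x : x_i = l_i for all i ∈ I}`.
Its dimension is the number of coordinates outside `I`. -/
def genHyperplane (I : Set ι) (l : I → ℝ) : Set (ι → ℝ) :=
  {x | ∀ i : I, x i = l i}

/-- A pure full-dimensional orthogonal polytope: a finite union of boxes `∏ [a_i, b_i]` with
`a_i < b_i` for all `i`. (`Set.Icc a b` is the product of the intervals `[a_i, b_i]`.) -/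
def IsPureOrthogonalPolytope (P : Set (ι → ℝ)) : Prop :=
  ∃ B : Finset ((ι → ℝ) × (ι → ℝ)),
    (∀ b ∈ B, ∀ i, b.1 i < b.2 i) ∧ P = ⋃ b ∈ B, Set.Icc b.1 b.2

/-- The closed half-space `s H_i`, where `H_i = {x : x_i ≥ 0}` and `s = ±1`. -/
def halfSpace (s : ℤˣ) (i : ι) : Set (ι → ℝ) :=
  {x | 0 ≤ ((s : ℤ) : ℝ) * x i}

/-- The closed orthant `Ω_s`. -/
def orthant (s : ι → ℤˣ) : Set (ι → ℝ) :=
  {x | ∀ i, 0 ≤ ((s i : ℤ) : ℝ) * x i}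

/-- A local orthotopal arrangement: a union of orthants. -/
def IsLocalArrangement (α : Set (ι → ℝ)) : Prop :=
  ∃ S : Set (ι → ℤˣ), α = ⋃ s ∈ S, orthant s

/-- `α` is the tangent cone of `P` at `v`: the local orthotopal arrangement such that, for some
`δ > 0`, the sets `P - v` and `α` agree inside the cube `[-δ, δ]^ι`. -/
def IsTangentCone (P : Set (ι → ℝ)) (v : ι → ℝ) (α : Set (ι → ℝ)) : Prop :=
  IsLocalArrangement α ∧
    ∃ δ : ℝ, 0 < δ ∧ ∀ x : ι → ℝ, (∀ i, |x i| ≤ δ) → (v + x ∈ P ↔ x ∈ α)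

/-- Congruence of arrangements: some symmetry of the cube `[-1, 1]^ι` (a permutation of the
coordinates combined with sign changes) carries `α` onto `β`. -/
def Congruent (α β : Set (ι → ℝ)) : Prop :=
  ∃ (f : Equiv.Perm ι) (s : ι → ℤˣ),
    β = (fun (x : ι → ℝ) (i : ι) => ((s i : ℤ) : ℝ) * x (f i)) '' α

/-- The tangent cones of `P` at `v` and at `w` are congruent. -/
def CongruentAt (P : Set (ι → ℝ)) (v w : ι → ℝ) : Prop :=
  ∃ α β, IsTangentCone P v α ∧ IsTangentCone P w β ∧ Congruent α β

/-- The genericity region of `v`: all points which can be joined to `v` by a path in `P` along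
which every tangent cone is congruent to the tangent cone at `v`. -/
def genericityRegion (P : Set (ι → ℝ)) (v : ι → ℝ) : Set (ι → ℝ) :=
  {w | JoinedIn {u | u ∈ P ∧ CongruentAt P v u} v w}

/-- The smallest dimension of a generalized hyperplane which contains `R`. (The infimum is over a
nonempty set of natural numbers: `I = ∅` gives the whole space.) -/
noncomputable def degree (R : Set (ι → ℝ)) : ℕ :=
  sInf {n | ∃ (I : Set ι) (l : I → ℝ), R ⊆ genHyperplane I l ∧ Nat.card (Iᶜ : Set ι) = n}

/-- `F` is a `k`-dimensional face of `P`: the closure of a genericity region of degree `k`. -/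
def IsFace (P : Set (ι → ℝ)) (k : ℕ) (F : Set (ι → ℝ)) : Prop :=
  ∃ v ∈ P, degree (genericityRegion P v) = k ∧ F = closure (genericityRegion P v)

/-- `v` is a singular point of `P`: its genericity region has degree zero. -/
def IsSingularPoint (P : Set (ι → ℝ)) (v : ι → ℝ) : Prop :=
  v ∈ P ∧ degree (genericityRegion P v) = 0

/-- Parse trees of series-parallel diagrams with edges labelled by elements of `ι`. The honorary
diagram without edges is treated in `IsFloralArrangement`. -/
inductive SPD (ι : Type*) where
  | edge (i : ι) : SPD ι
  | series (Δ₁ Δ₂ : SPD ι) : SPD ι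
  | parallel (Δ₁ Δ₂ : SPD ι) : SPD ι

/-- The list of the edge labels of a diagram. -/
def SPD.edges : SPD ι → List ι
  | .edge i => [i]
  | .series Δ₁ Δ₂ => Δ₁.edges ++ Δ₂.edges
  | .parallel Δ₁ Δ₂ => Δ₁.edges ++ Δ₂.edges

/-- The set determined by a signed diagram: series connection is intersection, parallel connection
is union, and the edge `i` is the half-space `s_i H_i`. -/
def SPD.arrangement (s : ι → ℤˣ) : SPD ι → Set (ι → ℝ)
  | .edge i => halfSpace (s i) i
  | .series Δ₁ Δ₂ => Δ₁.arrangement s ∩ Δ₂.arrangement s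
  | .parallel Δ₁ Δ₂ => Δ₁.arrangement s ∪ Δ₂.arrangement s

/-- `α` is a floral arrangement with edge set `E`: it is determined by a signed series-parallel
diagram in which every element of `E`, and nothing else, labels exactly one edge. The diagram
without edges (`E = ∅`) determines the whole space. -/
def IsFloralArrangement (E : Set ι) (α : Set (ι → ℝ)) : Prop :=
  (E = ∅ ∧ α = Set.univ) ∨
    ∃ (Δ : SPD ι) (s : ι → ℤˣ),
      Δ.edges.Nodup ∧ (∀ i, i ∈ Δ.edges ↔ i ∈ E) ∧ α = Δ.arrangement s

/-- A floral vertex: a floral arrangement which uses every coordinate. -/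
def IsFloralVertex (α : Set (ι → ℝ)) : Prop :=
  IsFloralArrangement Set.univ α

/-- A full-dimensional generic orthotope in `ι → ℝ`: a pure orthogonal polytope whose tangent cone
at every singular point is a floral vertex. -/
def IsGenericOrthotope (P : Set (ι → ℝ)) : Prop :=
  IsPureOrthogonalPolytope P ∧
    ∀ v, IsSingularPoint P v → ∃ α, IsTangentCone P v α ∧ IsFloralVertex α

/-- `Q` is a generic orthotope of dimension `k`, possibly inside a space of larger dimension: it
lies in a `k`-dimensional generalized hyperplane `Π_{I,l}`, and it is a full-dimensional generic
orthotope there when `Π_{I,l}` is identified with the `k`-dimensional space with coordinates `Iᶜ`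
by forgetting the constant coordinates. -/
def IsGenericOrthotopeOfDim (k : ℕ) (Q : Set (ι → ℝ)) : Prop :=
  ∃ (I : Set ι) (l : I → ℝ), Nat.card (Iᶜ : Set ι) = k ∧ Q ⊆ genHyperplane I l ∧
    IsGenericOrthotope ((fun (x : ι → ℝ) (j : (Iᶜ : Set ι)) => x j) '' Q)

end Orthotope

/-!
Near each of its points, an orthogonal polytope is a union of orthants, so its tangent cones are
encoded by sets of sign vectors (`cone`, `germ`), and the tangent cone at a nearby point is a
section of the set at the given point (`localize`, `HasGerms.eventually_germ_eq`). Such a section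
depends on fewer coordinates unless nothing changes (`restr_eq_self`). Hence the tangent cone is
constant along a genericity region, and the region is a relatively open subset of the hyperplane
which fixes the coordinates `E` on which this cone depends; its degree is the number of the other
coordinates (`HasGerms.degree_genericityRegion`).

Floral arrangements correspond to read-once Boolean functions (`ReadOnce`, `Floral`). Sections of
read-once functions are read-once, and every tangent cone of a generic orthotope arises by sections
from the one at a singular point, so all of them are floral (`IsGenericOrthotope.exists_floral`).

Let `F` be the closure of the region of `v`, and let `u ∈ F`. The points near `u` with the same
tangent cone as `v` are those whose signs outside `E` reduce the read-once function at `u` to the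
one at `v`. For this, each maximal subformula without variables in `E` has to take its neutral
value, so these signs again form a read-once set (`ReadOnce.floral_neutral`). As read-once sets are
unate, these points are connected near `u`, and therefore belong to the same region. So the tangent
cone of `F` at `u` is floral (`HasGerms.eventually_mem_closure_iff`). Being compact, `F` is then
covered by finitely many boxes contained in it (`isPureOrthogonalPolytope_of_hasGerm`), and at a
singular point of `F` the floral tangent cone has to use all coordinates outside `E`.
-/

namespace Orthotope

open scoped Classical Topology
open Filter

variable {ι : Type*}

/-! ### Sets of sign vectors -/

/-- The local arrangement made of the orthants `Ω_s` with `s ∈ S`. -/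
def cone (S : Set (ι → ℤˣ)) : Set (ι → ℝ) := ⋃ s ∈ S, orthant s

/-- The section of `S` obtained by fixing the coordinates outside `Z` to their values in `t`. -/
def restr (Z : Set ι) (t : ι → ℤˣ) (S : Set (ι → ℤˣ)) : Set (ι → ℤˣ) :=
  {s | Z.piecewise s t ∈ S}

/-- The coordinates on which membership in `S` depends. -/
def essential (S : Set (ι → ℤˣ)) : Set ι :=
  {i | ∃ s ∈ S, Function.update s i (-(s i)) ∉ S}

/-- Membership in `S` is determined by the coordinates in `A`. -/
def SupportedOn (A : Set ι) (S : Set (ι → ℤˣ)) : Prop :=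
  ∀ s t : ι → ℤˣ, (∀ i ∈ A, s i = t i) → (s ∈ S ↔ t ∈ S)

theorem SupportedOn.mono {A B : Set ι} {S : Set (ι → ℤˣ)} (h : SupportedOn A S) (hAB : A ⊆ B) :
    SupportedOn B S :=
  fun s t hst => h s t fun i hi => hst i (hAB hi)

theorem SupportedOn.compl {A : Set ι} {S : Set (ι → ℤˣ)} (h : SupportedOn A S) :
    SupportedOn A Sᶜ :=
  fun s t hst => not_congr (h s t hst)

theorem SupportedOn.inter {A : Set ι} {S T : Set (ι → ℤˣ)} (h : SupportedOn A S)
    (h' : SupportedOn A T) : SupportedOn A (S ∩ T) :=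
  fun s t hst => and_congr (h s t hst) (h' s t hst)

theorem SupportedOn.essential_subset {A : Set ι} {S : Set (ι → ℤˣ)} (h : SupportedOn A S) :
    essential S ⊆ A := by
  rintro i ⟨s, hs, hs'⟩
  by_contra hi
  refine hs' ((h _ _ fun j hj => ?_).1 hs)
  rw [Function.update_of_ne]
  rintro rfl
  exact hi hj

theorem essential_compl (S : Set (ι → ℤˣ)) : essential Sᶜ = essential S := by
  have key : ∀ S : Set (ι → ℤˣ), essential Sᶜ ⊆ essential S := by
    rintro S i ⟨s, hs, hs'⟩
    refine ⟨_, not_not.1 hs', ?_⟩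
    simpa using hs
  exact (key S).antisymm (by simpa using key Sᶜ)

theorem mem_iff_of_eqOn_essential [Finite ι] {S : Set (ι → ℤˣ)} {s t : ι → ℤˣ}
    (h : ∀ i ∈ essential S, s i = t i) : s ∈ S ↔ t ∈ S := by
  have flip : ∀ (s : ι → ℤˣ) (i : ι), i ∉ essential S → ∀ a,
      (Function.update s i a ∈ S ↔ s ∈ S) := by
    intro s i hi a
    rcases eq_or_ne a (s i) with rfl | ha
    · simp
    have ha' : a = -(s i) := by
      rcases Int.units_eq_one_or a with h1 | h1 <;> rcases Int.units_eq_one_or (s i) with h2 | h2 <;>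
        simp_all
    subst ha'
    constructor
    · intro h1
      by_contra h2
      exact hi ⟨_, h1, by simpa using h2⟩
    · intro h1
      by_contra h2
      exact hi ⟨_, h1, h2⟩
  have main : ∀ A : Set ι, A.Finite → Disjoint A (essential S) →
      (A.piecewise t s ∈ S ↔ s ∈ S) := by
    intro A hA
    induction A, hA using Set.Finite.induction_on with
    | empty => simp
    | @insert a A _ _ ih =>
      intro hd
      rw [Set.disjoint_insert_left] at hd
      rw [Set.piecewise_insert, flip _ _ hd.1, ih hd.2]
  have key : ∀ A : Set ι, Disjoint A (essential S) → (∀ i ∉ A, s i = t i) → (s ∈ S ↔ t ∈ S) := by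
    intro A hA hst
    have : A.piecewise t s = t := by
      ext1 i
      by_cases hi : i ∈ A
      · simp [hi]
      · simp [hi, hst i hi]
    rw [← main A A.toFinite hA, this]
  exact key (essential S)ᶜ disjoint_compl_left fun i hi => h i (not_not.1 hi)

theorem SupportedOn.of_essential [Finite ι] (S : Set (ι → ℤˣ)) : SupportedOn (essential S) S :=
  fun _ _ h => mem_iff_of_eqOn_essential h

theorem eq_univ_of_essential_eq_empty [Finite ι] {S : Set (ι → ℤˣ)} (h : essential S = ∅)
    (hS : S.Nonempty) : S = Set.univ := by
  obtain ⟨s, hs⟩ := hS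
  refine Set.eq_univ_of_forall fun t => (mem_iff_of_eqOn_essential (s := s) ?_).1 hs
  simp [h]

theorem essential_restr_subset (Z : Set ι) (t : ι → ℤˣ) (S : Set (ι → ℤˣ)) :
    essential (restr Z t S) ⊆ essential S ∩ Z := by
  rintro i ⟨s, hs, hs'⟩
  by_cases hi : i ∈ Z
  · refine ⟨⟨_, hs, ?_⟩, hi⟩
    have : Function.update (Z.piecewise s t) i (-(Z.piecewise s t i)) =
        Z.piecewise (Function.update s i (-(s i))) t := by
      ext1 j
      rcases eq_or_ne j i with rfl | hji
      · simp [hi]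
      · by_cases hj : j ∈ Z <;> simp [hj, hji]
    rw [this]
    exact hs'
  · refine absurd hs ?_
    have : Z.piecewise (Function.update s i (-(s i))) t = Z.piecewise s t := by
      ext1 j
      by_cases hj : j ∈ Z
      · have : j ≠ i := by rintro rfl; exact hi hj
        simp [hj, this]
      · simp [hj]
    change ¬ (_ ∈ S)
    rw [← this]
    exact hs'

/-- A section which still depends on as many coordinates as `S` is `S` itself. -/
theorem restr_eq_self [Finite ι] {Z : Set ι} {t : ι → ℤˣ} {S : Set (ι → ℤˣ)}
    (h : (essential S).ncard ≤ (essential (restr Z t S)).ncard) :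
    essential S ⊆ Z ∧ restr Z t S = S := by
  have h1 := essential_restr_subset Z t S
  have h2 : essential (restr Z t S) = essential S :=
    Set.eq_of_subset_of_ncard_le (h1.trans Set.inter_subset_left) h (Set.toFinite _)
  have h3 : essential S ⊆ Z := by
    rw [← h2]
    exact h1.trans Set.inter_subset_right
  refine ⟨h3, Set.ext fun s => ?_⟩
  refine mem_iff_of_eqOn_essential (s := Z.piecewise s t) fun i hi => ?_
  exact Set.piecewise_eq_of_mem _ _ _ (h3 hi)

theorem restr_inter (Z : Set ι) (t : ι → ℤˣ) (S T : Set (ι → ℤˣ)) :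
    restr Z t (S ∩ T) = restr Z t S ∩ restr Z t T := rfl

theorem restr_compl (Z : Set ι) (t : ι → ℤˣ) (S : Set (ι → ℤˣ)) :
    restr Z t Sᶜ = (restr Z t S)ᶜ := rfl

theorem essential_nonempty_iff [Finite ι] {S : Set (ι → ℤˣ)} :
    (essential S).Nonempty ↔ S.Nonempty ∧ Sᶜ.Nonempty := by
  constructor
  · rintro ⟨i, s, hs, hs'⟩
    exact ⟨⟨s, hs⟩, ⟨_, hs'⟩⟩
  · rintro ⟨h1, s, hs⟩
    by_contra h
    rw [Set.not_nonempty_iff_eq_empty] at h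
    exact hs (eq_univ_of_essential_eq_empty h h1 ▸ Set.mem_univ s)

theorem essential_inter_of_disjoint {A B : Set ι} {S T : Set (ι → ℤˣ)} (hAB : Disjoint A B)
    (hS : SupportedOn A S) (hT : SupportedOn B T) (hTn : T.Nonempty) :
    essential S ⊆ essential (S ∩ T) := by
  rintro i ⟨s, hs, hs'⟩
  obtain ⟨t, ht⟩ := hTn
  have hi : i ∈ A := hS.essential_subset ⟨s, hs, hs'⟩
  have e1 : ∀ j ∈ A, s j = A.piecewise s t j := fun j hj => by simp [hj]
  refine ⟨A.piecewise s t, ⟨(hS _ _ e1).1 hs, (hT _ _ fun j hj => ?_).1 ht⟩, fun h => hs' ?_⟩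
  · rw [Set.piecewise_eq_of_notMem _ _ _ (hAB.notMem_of_mem_right hj)]
  · refine (hS _ _ fun j hj => ?_).1 h.1
    rcases eq_or_ne j i with rfl | hji
    · simp [hj]
    · simp [hji, hj]

/-! ### Read-once sets of sign vectors -/

/-- `S` is given by a read-once formula in the conditions `t i = e` in which each variable in
`E`, and no other, occurs exactly once. Complements are allowed instead of unions, which is
equivalent by De Morgan's laws. -/
inductive ReadOnce : Set ι → Set (ι → ℤˣ) → Prop where
  | edge (i : ι) (e : ℤˣ) : ReadOnce {i} {t | t i = e}
  | compl {E : Set ι} {S : Set (ι → ℤˣ)} : ReadOnce E S → ReadOnce E Sᶜ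
  | inter {A B : Set ι} {S T : Set (ι → ℤˣ)} : Disjoint A B → ReadOnce A S → ReadOnce B T →
      ReadOnce (A ∪ B) (S ∩ T)

/-- A read-once set of sign vectors, or the set of all sign vectors with no variables. -/
def Floral (E : Set ι) (S : Set (ι → ℤˣ)) : Prop :=
  (E = ∅ ∧ S = Set.univ) ∨ ReadOnce E S

theorem Floral.inter {A B : Set ι} {S T : Set (ι → ℤˣ)} (hAB : Disjoint A B)
    (hS : Floral A S) (hT : Floral B T) : Floral (A ∪ B) (S ∩ T) := by
  rcases hS with ⟨rfl, rfl⟩ | hS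
  · rwa [Set.empty_union, Set.univ_inter]
  rcases hT with ⟨rfl, rfl⟩ | hT
  · rw [Set.union_empty, Set.inter_univ]
    exact Or.inr hS
  exact Or.inr (.inter hAB hS hT)

theorem ReadOnce.supportedOn {E : Set ι} {S : Set (ι → ℤˣ)} (h : ReadOnce E S) :
    SupportedOn E S := by
  induction h with
  | edge i e =>
    intro s t hst
    simp [hst i rfl]
  | compl _ ih => exact ih.compl
  | inter _ _ _ ih₁ ih₂ =>
    exact (ih₁.mono Set.subset_union_left).inter (ih₂.mono Set.subset_union_right)

theorem essential_edge (i : ι) (e : ℤˣ) : essential {t : ι → ℤˣ | t i = e} = {i} := by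
  refine (ReadOnce.edge i e).supportedOn.essential_subset.antisymm ?_
  rintro _ rfl
  refine ⟨fun _ => e, rfl, ?_⟩
  rcases Int.units_eq_one_or e with rfl | rfl <;> simp

theorem ReadOnce.nonempty {E : Set ι} {S : Set (ι → ℤˣ)} (h : ReadOnce E S) : E.Nonempty := by
  induction h with
  | edge i e => exact ⟨i, rfl⟩
  | compl _ ih => exact ih
  | inter _ _ _ ih₁ _ => exact ih₁.mono Set.subset_union_left

theorem ReadOnce.essential_eq [Finite ι] {E : Set ι} {S : Set (ι → ℤˣ)} (h : ReadOnce E S) :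
    essential S = E := by
  induction h with
  | edge i e => exact essential_edge i e
  | compl _ ih => rw [essential_compl, ih]
  | @inter A B S T hd h₁ h₂ ih₁ ih₂ =>
    refine (ReadOnce.inter hd h₁ h₂).supportedOn.essential_subset.antisymm
      (Set.union_subset ?_ ?_)
    · have := essential_inter_of_disjoint hd h₁.supportedOn h₂.supportedOn
        (essential_nonempty_iff.1 (ih₂ ▸ h₂.nonempty)).1
      rwa [ih₁] at this
    · have := essential_inter_of_disjoint hd.symm h₂.supportedOn h₁.supportedOn
        (essential_nonempty_iff.1 (ih₁ ▸ h₁.nonempty)).1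
      rwa [ih₂, Set.inter_comm] at this

theorem Floral.essential_eq [Finite ι] {E : Set ι} {S : Set (ι → ℤˣ)} (h : Floral E S) :
    essential S = E := by
  rcases h with ⟨rfl, rfl⟩ | h
  · simp [essential]
  · exact h.essential_eq

/-- A section of a read-once set is empty, everything, or read-once. -/
theorem ReadOnce.restr_cases {E : Set ι} {S : Set (ι → ℤˣ)} (h : ReadOnce E S) (Z : Set ι)
    (t : ι → ℤˣ) : restr Z t S = ∅ ∨ restr Z t S = Set.univ ∨
      ∃ E' ⊆ E, ReadOnce E' (restr Z t S) := by
  induction h with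
  | edge i e =>
    by_cases hi : i ∈ Z
    · refine Or.inr (Or.inr ⟨{i}, subset_rfl, ?_⟩)
      have : restr Z t {t | t i = e} = {t | t i = e} := by
        ext s; simp [restr, hi]
      rw [this]
      exact .edge i e
    · by_cases he : t i = e
      · refine Or.inr (Or.inl ?_)
        ext s; simp [restr, hi, he]
      · refine Or.inl ?_
        ext s; simp [restr, hi, he]
  | compl _ ih =>
    rw [restr_compl]
    rcases ih with h | h | ⟨E', hE', h⟩
    · simp [h]
    · simp [h]
    · exact Or.inr (Or.inr ⟨E', hE', h.compl⟩)
  | @inter A B S T hd h₁ h₂ ih₁ ih₂ =>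
    rw [restr_inter]
    rcases ih₁ with h | h | ⟨E₁, hE₁, h⟩
    · simp [h]
    · rw [h, Set.univ_inter]
      rcases ih₂ with h | h | ⟨E₂, hE₂, h⟩
      · simp [h]
      · simp [h]
      · exact Or.inr (Or.inr ⟨E₂, hE₂.trans Set.subset_union_right, h⟩)
    · rcases ih₂ with h' | h' | ⟨E₂, hE₂, h'⟩
      · simp [h']
      · rw [h', Set.inter_univ]
        exact Or.inr (Or.inr ⟨E₁, hE₁.trans Set.subset_union_left, h⟩)
      · exact Or.inr (Or.inr ⟨_, Set.union_subset_union hE₁ hE₂, .inter (hd.mono hE₁ hE₂) h h'⟩)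

theorem Floral.exists_floral_restr {E : Set ι} {S : Set (ι → ℤˣ)} (h : Floral E S) {Z : Set ι}
    {t : ι → ℤˣ} (hn : (restr Z t S).Nonempty) : ∃ E', Floral E' (restr Z t S) := by
  rcases h with ⟨rfl, rfl⟩ | h
  · exact ⟨∅, Or.inl ⟨rfl, by ext; simp [restr]⟩⟩
  · rcases h.restr_cases Z t with h | h | ⟨E', -, h⟩
    · exact absurd h hn.ne_empty
    · exact ⟨∅, Or.inl ⟨rfl, h⟩⟩
    · exact ⟨E', Or.inr h⟩

/-- Read-once sets are unate: there is a sign vector `e` such that `S` is stable under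
replacing coordinates by those of `e`. -/
theorem ReadOnce.exists_monotone {E : Set ι} {S : Set (ι → ℤˣ)} (h : ReadOnce E S) :
    ∃ e : ι → ℤˣ, ∀ s ∈ S, ∀ t : ι → ℤˣ, (∀ i, t i = s i ∨ t i = e i) → t ∈ S := by
  induction h with
  | edge i e =>
    refine ⟨fun _ => e, fun s hs t ht => ?_⟩
    rcases ht i with h | h
    · exact h.trans hs
    · exact h
  | @compl E S _ ih =>
    obtain ⟨e, he⟩ := ih
    refine ⟨-e, fun s hs t ht hS => hs (he t hS s fun i => ?_)⟩
    rcases ht i with h | h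
    · exact Or.inl h.symm
    · rcases Int.units_eq_one_or (s i) with h1 | h1 <;>
        rcases Int.units_eq_one_or (e i) with h2 | h2 <;> simp_all
  | @inter A B S T hd h₁ h₂ ih₁ ih₂ =>
    obtain ⟨e₁, he₁⟩ := ih₁
    obtain ⟨e₂, he₂⟩ := ih₂
    refine ⟨A.piecewise e₁ e₂, fun s hs t ht => ⟨?_, ?_⟩⟩
    · refine (h₁.supportedOn (A.piecewise t s) t fun i hi => by simp [hi]).1
        (he₁ s hs.1 _ fun i => ?_)
      by_cases hi : i ∈ A
      · simpa [hi] using ht i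
      · simp [hi]
    · refine (h₂.supportedOn (B.piecewise t s) t fun i hi => by simp [hi]).1
        (he₂ s hs.2 _ fun i => ?_)
      by_cases hi : i ∈ B
      · simpa [hi, hd.notMem_of_mem_right hi] using ht i
      · simp [hi]

theorem Floral.exists_monotone {E : Set ι} {S : Set (ι → ℤˣ)} (h : Floral E S) :
    ∃ e : ι → ℤˣ, ∀ s ∈ S, ∀ t : ι → ℤˣ, (∀ i, t i = s i ∨ t i = e i) → t ∈ S := by
  rcases h with ⟨-, rfl⟩ | h
  · exact ⟨1, fun _ _ _ _ => trivial⟩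
  · exact h.exists_monotone

theorem restr_congr {A Z Z' : Set ι} {t t' : ι → ℤˣ} {S : Set (ι → ℤˣ)} (hS : SupportedOn A S)
    (h : ∀ i ∈ A, (i ∈ Z ↔ i ∈ Z') ∧ (i ∉ Z → t i = t' i)) : restr Z t S = restr Z' t' S := by
  ext s
  refine hS _ _ fun i hi => ?_
  by_cases hZ : i ∈ Z
  · simp [hZ, (h i hi).1.1 hZ]
  · simp [hZ, mt (h i hi).1.2 hZ, (h i hi).2 hZ]

theorem supportedOn_restr {A : Set ι} (Z : Set ι) (t : ι → ℤˣ) {S : Set (ι → ℤˣ)}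
    (hS : SupportedOn A S) : SupportedOn (A ∩ Z) (restr Z t S) := by
  intro s s' h
  refine hS _ _ fun i hi => ?_
  by_cases hZ : i ∈ Z
  · simp [hZ, h i ⟨hi, hZ⟩]
  · simp [hZ]

/-- The sign vectors `t` for which the section of `S` at `t` depends on all variables in `E`. -/
def neutral (E : Set ι) (S : Set (ι → ℤˣ)) : Set (ι → ℤˣ) :=
  {t | E ⊆ essential (restr E t S)}

theorem neutral_compl (E : Set ι) (S : Set (ι → ℤˣ)) : neutral E Sᶜ = neutral E S := by
  simp only [neutral, restr_compl, essential_compl]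

theorem neutral_inter_left [Finite ι] {B E : Set ι} {S T : Set (ι → ℤˣ)}
    (hT : SupportedOn B T) (hE : E.Nonempty) (hEB : Disjoint B E) :
    neutral E (S ∩ T) = neutral E S ∩ T ∧
      ∀ t ∈ neutral E (S ∩ T), restr E t (S ∩ T) = restr E t S := by
  have hr : ∀ t, restr E t T = {_s | t ∈ T} := by
    intro t
    ext s
    exact hT _ _ fun i hi => by simp [hEB.notMem_of_mem_left hi]
  have h2 : ∀ t ∈ neutral E (S ∩ T), t ∈ T := by
    intro t ht
    obtain ⟨s, hs⟩ := (essential_nonempty_iff.1 (hE.mono ht)).1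
    rw [restr_inter, hr] at hs
    exact hs.2
  have h1 : ∀ t ∈ T, restr E t (S ∩ T) = restr E t S := by
    intro t ht
    simp [restr_inter, hr, ht]
  refine ⟨?_, fun t ht => h1 t (h2 t ht)⟩
  ext t
  constructor
  · intro ht
    have := h2 t ht
    refine ⟨?_, this⟩
    rwa [neutral, Set.mem_ofPred_eq, h1 t this] at ht
  · rintro ⟨ht, ht'⟩
    rwa [neutral, Set.mem_ofPred_eq, h1 t ht']

theorem neutral_inter [Finite ι] {A B E : Set ι} {S T : Set (ι → ℤˣ)} (hAB : Disjoint A B)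
    (hS : SupportedOn A S) (hT : SupportedOn B T) (hE : E ⊆ A ∪ B) (hA : (E ∩ A).Nonempty)
    (hB : (E ∩ B).Nonempty) :
    neutral E (S ∩ T) = neutral (E ∩ A) S ∩ neutral (E ∩ B) T := by
  have eS : ∀ t, restr E t S = restr (E ∩ A) t S := fun t =>
    restr_congr hS fun i hi => by simp [hi]
  have eT : ∀ t, restr E t T = restr (E ∩ B) t T := fun t =>
    restr_congr hT fun i hi => by simp [hi]
  ext t
  have sS : SupportedOn A (restr E t S) := (supportedOn_restr E t hS).mono Set.inter_subset_left
  have sT : SupportedOn B (restr E t T) := (supportedOn_restr E t hT).mono Set.inter_subset_left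
  constructor
  · intro ht
    have hne := (essential_nonempty_iff.1 ((hA.mono Set.inter_subset_left).mono ht)).1
    rw [restr_inter] at hne
    have hsub : E ⊆ essential (restr E t S) ∪ essential (restr E t T) := by
      refine Set.Subset.trans ht ?_
      refine SupportedOn.essential_subset (SupportedOn.inter ?_ ?_)
      · exact (SupportedOn.of_essential _).mono Set.subset_union_left
      · exact (SupportedOn.of_essential _).mono Set.subset_union_right
    constructor
    · rw [neutral, Set.mem_ofPred_eq, ← eS]
      intro i hi
      exact (hsub hi.1).resolve_right fun h =>
        hAB.notMem_of_mem_left hi.2 (sT.essential_subset h)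
    · rw [neutral, Set.mem_ofPred_eq, ← eT]
      intro i hi
      exact (hsub hi.1).resolve_left fun h =>
        hAB.notMem_of_mem_right hi.2 (sS.essential_subset h)
  · rintro ⟨h1, h2⟩
    rw [neutral, Set.mem_ofPred_eq, ← eS] at h1
    rw [neutral, Set.mem_ofPred_eq, ← eT] at h2
    have n1 := (essential_nonempty_iff.1 (hA.mono h1)).1
    have n2 := (essential_nonempty_iff.1 (hB.mono h2)).1
    intro i hi
    rw [restr_inter]
    rcases hE hi with h | h
    · exact essential_inter_of_disjoint hAB sS sT n2 (h1 ⟨hi, h⟩)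
    · rw [Set.inter_comm]
      exact essential_inter_of_disjoint hAB.symm sT sS n1 (h2 ⟨hi, h⟩)

/-- The sections of a read-once set which depend on all variables in a given nonempty set `E`
are all equal, and they are cut out by a read-once condition on the remaining variables: every
maximal subformula without variables in `E` has to take the neutral value of the operation which
joins it to the rest of the formula. -/
theorem ReadOnce.floral_neutral [Finite ι] {D : Set ι} {S : Set (ι → ℤˣ)} (h : ReadOnce D S) :
    ∀ E ⊆ D, E.Nonempty → (neutral E S).Nonempty → Floral (D \ E) (neutral E S) ∧
      ∀ t ∈ neutral E S, ∀ t' ∈ neutral E S, restr E t S = restr E t' S := by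
  induction h with
  | edge i e =>
    intro E hE hn _
    obtain rfl := (Set.subset_singleton_iff_eq.1 hE).resolve_left hn.ne_empty
    have hr : ∀ t, restr {i} t {t | t i = e} = {t | t i = e} := by
      intro t
      ext s
      simp [restr]
    refine ⟨Or.inl ⟨by simp, ?_⟩, fun t _ t' _ => by rw [hr, hr]⟩
    ext t
    simp [neutral, hr, essential_edge]
  | compl _ ih =>
    intro E hE hn hG
    rw [neutral_compl] at hG ⊢
    refine ⟨(ih E hE hn hG).1, fun t ht t' ht' => ?_⟩
    rw [restr_compl, restr_compl, (ih E hE hn hG).2 t ht t' ht']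
  | @inter A B S T hd h₁ h₂ ih₁ ih₂ =>
    -- All variables of `E` occur in the first formula, so the second one has to be true.
    have one : ∀ {A B : Set ι} {S T : Set (ι → ℤˣ)}, Disjoint A B → ReadOnce B T →
        ∀ E ⊆ A, E.Nonempty →
        ((neutral E S).Nonempty → Floral (A \ E) (neutral E S) ∧ ∀ t ∈ neutral E S,
          ∀ t' ∈ neutral E S, restr E t S = restr E t' S) →
        (neutral E (S ∩ T)).Nonempty → Floral ((A ∪ B) \ E) (neutral E (S ∩ T)) ∧
        ∀ t ∈ neutral E (S ∩ T), ∀ t' ∈ neutral E (S ∩ T),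
          restr E t (S ∩ T) = restr E t' (S ∩ T) := by
      intro A B S T hd h₂ E hEA hn ih hG
      have hBE : Disjoint B E := (hd.mono_left hEA).symm
      obtain ⟨e1, e2⟩ := neutral_inter_left (S := S) h₂.supportedOn hn hBE
      have hG' : (neutral E S).Nonempty := by
        rw [e1] at hG
        exact hG.mono Set.inter_subset_left
      constructor
      · rw [e1, Set.union_sdiff_distrib, hBE.sdiff_eq_left]
        exact (ih hG').1.inter (hd.mono_left Set.sdiff_subset) (Or.inr h₂)
      · intro t ht t' ht'
        rw [e2 t ht, e2 t' ht']
        rw [e1] at ht ht'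
        exact (ih hG').2 t ht.1 t' ht'.1
    intro E hE hn hG
    by_cases hB : (E ∩ B).Nonempty
    · by_cases hA : (E ∩ A).Nonempty
      · have e := neutral_inter hd h₁.supportedOn h₂.supportedOn hE hA hB
        have hG₁ : (neutral (E ∩ A) S).Nonempty := by
          rw [e] at hG
          exact hG.mono Set.inter_subset_left
        have hG₂ : (neutral (E ∩ B) T).Nonempty := by
          rw [e] at hG
          exact hG.mono Set.inter_subset_right
        obtain ⟨f₁, g₁⟩ := ih₁ _ Set.inter_subset_right hA hG₁
        obtain ⟨f₂, g₂⟩ := ih₂ _ Set.inter_subset_right hB hG₂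
        constructor
        · have : (A ∪ B) \ E = (A \ (E ∩ A)) ∪ (B \ (E ∩ B)) := by
            ext i
            simp only [Set.mem_sdiff, Set.mem_union, Set.mem_inter_iff]
            tauto
          rw [e, this]
          exact f₁.inter (hd.mono Set.sdiff_subset Set.sdiff_subset) f₂
        · intro t ht t' ht'
          rw [e] at ht ht'
          have eS : ∀ t, restr E t S = restr (E ∩ A) t S := fun t =>
            restr_congr h₁.supportedOn fun i hi => by simp [hi]
          have eT : ∀ t, restr E t T = restr (E ∩ B) t T := fun t =>
            restr_congr h₂.supportedOn fun i hi => by simp [hi]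
          rw [restr_inter, restr_inter, eS, eS, eT, eT, g₁ t ht.1 t' ht'.1, g₂ t ht.2 t' ht'.2]
      · have hEB : E ⊆ B := fun i hi =>
          (hE hi).resolve_left fun h => hA ⟨i, hi, h⟩
        rw [Set.union_comm, Set.inter_comm]
        rw [Set.inter_comm] at hG
        exact one hd.symm h₁ E hEB hn (ih₂ E hEB hn) hG
    · have hEA : E ⊆ A := fun i hi =>
        (hE hi).resolve_right fun h => hB ⟨i, hi, h⟩
      exact one hd h₂ E hEA hn (ih₁ E hEA hn) hG

/-- The sign vectors at which the section of a floral set is a given nonempty set `S₀` form a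
floral set. -/
theorem Floral.floral_restr_eq [Finite ι] {D : Set ι} {S S₀ : Set (ι → ℤˣ)} (h : Floral D S)
    (hS₀ : S₀.Nonempty) (hn : {t | restr (essential S₀) t S = S₀}.Nonempty) :
    Floral (D \ essential S₀) {t | restr (essential S₀) t S = S₀} := by
  rcases h with ⟨rfl, rfl⟩ | h
  · obtain ⟨t, ht⟩ := hn
    refine Or.inl ⟨by simp, Set.eq_univ_of_forall fun t' => ?_⟩
    exact Eq.trans rfl ht
  have hD : essential S₀ ⊆ D := by
    obtain ⟨t, ht⟩ := hn
    have := essential_restr_subset (essential S₀) t S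
    rw [show restr (essential S₀) t S = S₀ from ht, h.essential_eq] at this
    exact this.trans Set.inter_subset_left
  rcases (essential S₀).eq_empty_or_nonempty with he | he
  · rw [he, Set.sdiff_empty]
    obtain rfl := eq_univ_of_essential_eq_empty he hS₀
    have : {t | restr ∅ t S = Set.univ} = S := by
      ext t
      simp [restr, Set.eq_univ_iff_forall]
    rw [this]
    exact Or.inr h
  · obtain ⟨t₀, ht₀⟩ := hn
    have hsub : ∀ t, restr (essential S₀) t S = S₀ → t ∈ neutral (essential S₀) S := by
      intro t ht
      rw [neutral, Set.mem_ofPred_eq, ht]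
    obtain ⟨f, g⟩ := h.floral_neutral _ hD he ⟨t₀, hsub t₀ ht₀⟩
    have : {t | restr (essential S₀) t S = S₀} = neutral (essential S₀) S := by
      ext t
      exact ⟨hsub t, fun ht => (g t ht t₀ (hsub t₀ ht₀)).trans ht₀⟩
    rwa [this]

/-! ### Local arrangements and sets of sign vectors -/

/-- The signs of the coordinates of `x`; the sign of `0` is taken to be `1`. -/
noncomputable def signVec (x : ι → ℝ) : ι → ℤˣ := fun i => if 0 ≤ x i then 1 else -1

/-- A sign vector as a vector with entries `±1`. -/
def toVec (t : ι → ℤˣ) : ι → ℝ := fun i => ((t i : ℤ) : ℝ)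

/-- The sign vectors of the tangent cone of `cone S` at `x`. -/
noncomputable def localize (S : Set (ι → ℤˣ)) (x : ι → ℝ) : Set (ι → ℤˣ) :=
  restr {i | x i = 0} (signVec x) S

theorem sign_mul_nonneg_iff (u : ℤˣ) (x : ι → ℝ) (i : ι) :
    0 ≤ ((u : ℤ) : ℝ) * x i ↔ (x i ≠ 0 → u = signVec x i) := by
  rcases lt_trichotomy (x i) 0 with h | h | h
  · rcases Int.units_eq_one_or u with rfl | rfl
    · simp [signVec, h.not_ge, h.ne]
    · simp [signVec, h.not_ge, h.le]
  · simp [h]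
  · rcases Int.units_eq_one_or u with rfl | rfl
    · simp [signVec, h.le]
    · simp [signVec, h.le, h.ne', h]

theorem mem_orthant_iff {t : ι → ℤˣ} {x : ι → ℝ} :
    x ∈ orthant t ↔ ∀ i, x i ≠ 0 → t i = signVec x i :=
  forall_congr' fun i => sign_mul_nonneg_iff (t i) x i

theorem mem_cone {S : Set (ι → ℤˣ)} {x : ι → ℝ} :
    x ∈ cone S ↔ ∃ s ∈ S, ∀ i, x i ≠ 0 → s i = signVec x i := by
  simp only [cone, Set.mem_iUnion₂, exists_prop, mem_orthant_iff]

theorem signVec_smul_toVec {ε : ℝ} (hε : 0 < ε) (t : ι → ℤˣ) : signVec (ε • toVec t) = t := by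
  ext1 i
  rcases Int.units_eq_one_or (t i) with h | h
  · simp [signVec, toVec, h, hε.le]
  · simp [signVec, toVec, h, hε]

theorem toVec_ne_zero (t : ι → ℤˣ) (i : ι) : toVec t i ≠ 0 := by
  simp [toVec]

theorem smul_toVec_mem_cone {S : Set (ι → ℤˣ)} {ε : ℝ} (hε : 0 < ε) {t : ι → ℤˣ} :
    ε • toVec t ∈ cone S ↔ t ∈ S := by
  rw [mem_cone, signVec_smul_toVec hε]
  constructor
  · rintro ⟨s, hs, h⟩
    have : s = t := funext fun i => h i (mul_ne_zero hε.ne' (toVec_ne_zero t i))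
    exact this ▸ hs
  · exact fun h => ⟨t, h, fun _ _ => rfl⟩

theorem toVec_mem_cone {S : Set (ι → ℤˣ)} {t : ι → ℤˣ} : toVec t ∈ cone S ↔ t ∈ S := by
  simpa using smul_toVec_mem_cone (S := S) one_pos (t := t)

theorem cone_injective : Function.Injective (cone : Set (ι → ℤˣ) → Set (ι → ℝ)) :=
  fun S T h => by ext t; rw [← toVec_mem_cone, h, toVec_mem_cone]

theorem isClosed_cone [Finite ι] (S : Set (ι → ℤˣ)) : IsClosed (cone S) := by
  refine Set.Finite.isClosed_biUnion (Set.toFinite S) fun s _ => ?_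
  have : orthant s = ⋂ i, {x : ι → ℝ | 0 ≤ ((s i : ℤ) : ℝ) * x i} := by
    ext x; simp [orthant]
  rw [this]
  exact isClosed_iInter fun i => isClosed_le continuous_const (by fun_prop)

theorem cone_union (S T : Set (ι → ℤˣ)) : cone (S ∪ T) = cone S ∪ cone T :=
  Set.biUnion_union S T _

/-- Intersections of closed arrangements can be computed on sign vectors if the arrangements
depend on different coordinates. (In general they cannot: opposite half-spaces meet.) -/
theorem cone_inter_of_disjoint {A B : Set ι} {S T : Set (ι → ℤˣ)} (hAB : Disjoint A B)
    (hS : SupportedOn A S) (hT : SupportedOn B T) : cone (S ∩ T) = cone S ∩ cone T := by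
  ext x
  constructor
  · intro hx
    obtain ⟨s, hs, h⟩ := mem_cone.1 hx
    exact ⟨mem_cone.2 ⟨s, hs.1, h⟩, mem_cone.2 ⟨s, hs.2, h⟩⟩
  · rintro ⟨hx, hx'⟩
    obtain ⟨s, hs, h⟩ := mem_cone.1 hx
    obtain ⟨t, ht, h'⟩ := mem_cone.1 hx'
    refine mem_cone.2 ⟨A.piecewise s t, ⟨(hS s _ fun i hi => ?_).1 hs,
      (hT t _ fun i hi => ?_).1 ht⟩, fun i hi => ?_⟩
    · simp [hi]
    · simp [hAB.notMem_of_mem_right hi]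
    · by_cases hA : i ∈ A
      · simp [hA, h i hi]
      · simp [hA, h' i hi]

theorem eventually_signVec_eq [Finite ι] (x : ι → ℝ) :
    ∀ᶠ y in 𝓝 x, ∀ i, x i ≠ 0 → y i ≠ 0 ∧ signVec y i = signVec x i := by
  rw [eventually_all]
  intro i
  have hc : Tendsto (fun y : ι → ℝ => y i) (𝓝 x) (𝓝 (x i)) := (continuous_apply i).tendsto x
  rcases lt_trichotomy (x i) 0 with h | h | h
  · filter_upwards [hc.eventually_lt_const h] with y hy _
    exact ⟨hy.ne, by simp [signVec, h.not_ge, hy.not_ge]⟩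
  · exact Eventually.of_forall fun y h' => absurd h h'
  · filter_upwards [hc.eventually_const_lt h] with y hy _
    exact ⟨hy.ne', by simp [signVec, h.le, hy.le]⟩

/-- Near `x`, the arrangement `cone S` agrees with its tangent cone at `x`. -/
theorem eventually_mem_cone_iff [Finite ι] (S : Set (ι → ℤˣ)) (x : ι → ℝ) :
    ∀ᶠ y in 𝓝 x, (y ∈ cone S ↔ y - x ∈ cone (localize S x)) := by
  filter_upwards [eventually_signVec_eq x] with y hy
  rw [mem_cone, mem_cone]
  have key : ∀ i, x i = 0 → signVec (y - x) i = signVec y i ∧ (y - x) i = y i := by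
    intro i hi
    simp [signVec, hi]
  constructor
  · rintro ⟨s, hs, h⟩
    refine ⟨Set.piecewise {i | x i = 0} s (signVec (y - x)), ?_, fun i hi => ?_⟩
    · have : Set.piecewise {i | x i = 0} (Set.piecewise {i | x i = 0} s (signVec (y - x)))
          (signVec x) = s := by
        ext1 i
        by_cases hi : x i = 0
        · simp [hi]
        · simp [hi, h i (hy i hi).1, (hy i hi).2]
      change _ ∈ S
      rwa [this]
    · by_cases hx : x i = 0
      · rw [(key i hx).2] at hi
        simp [hx, h i hi, (key i hx).1]
      · simp [hx]
  · rintro ⟨s, hs, h⟩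
    refine ⟨_, hs, fun i hi => ?_⟩
    by_cases hx : x i = 0
    · rw [← (key i hx).2] at hi
      simp [hx, h i hi, (key i hx).1]
    · simp [hx, (hy i hx).2]

/-! ### Series-parallel diagrams and read-once sets -/

theorem cone_edge (i : ι) (e : ℤˣ) : cone {t : ι → ℤˣ | t i = e} = halfSpace e i := by
  ext x
  rw [mem_cone, halfSpace, Set.mem_ofPred_eq, sign_mul_nonneg_iff]
  constructor
  · rintro ⟨s, rfl, h⟩
    exact h i
  · intro h
    refine ⟨Function.update (signVec x) i e, by simp, fun j hj => ?_⟩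
    rcases eq_or_ne j i with rfl | hji
    · simpa using h hj
    · simp [hji]

theorem SPD.exists_readOnce (s : ι → ℤˣ) (Δ : SPD ι) (h : Δ.edges.Nodup) :
    ∃ S, ReadOnce {i | i ∈ Δ.edges} S ∧ Δ.arrangement s = cone S := by
  induction Δ with
  | edge i => exact ⟨_, by simpa [SPD.edges] using ReadOnce.edge i (s i), (cone_edge i (s i)).symm⟩
  | series Δ₁ Δ₂ ih₁ ih₂ =>
    rw [SPD.edges, List.nodup_append'] at h
    obtain ⟨S, hS, e⟩ := ih₁ h.1
    obtain ⟨T, hT, e'⟩ := ih₂ h.2.1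
    have hd : Disjoint {i | i ∈ Δ₁.edges} {i | i ∈ Δ₂.edges} :=
      Set.disjoint_left.2 fun i hi hi' => h.2.2 hi hi'
    refine ⟨S ∩ T, ?_, ?_⟩
    · convert ReadOnce.inter hd hS hT using 1
      ext i
      simp [SPD.edges]
    · rw [cone_inter_of_disjoint hd hS.supportedOn hT.supportedOn, SPD.arrangement, e, e']
  | parallel Δ₁ Δ₂ ih₁ ih₂ =>
    rw [SPD.edges, List.nodup_append'] at h
    obtain ⟨S, hS, e⟩ := ih₁ h.1
    obtain ⟨T, hT, e'⟩ := ih₂ h.2.1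
    have hd : Disjoint {i | i ∈ Δ₁.edges} {i | i ∈ Δ₂.edges} :=
      Set.disjoint_left.2 fun i hi hi' => h.2.2 hi hi'
    refine ⟨S ∪ T, ?_, ?_⟩
    · convert (ReadOnce.inter hd hS.compl hT.compl).compl using 1
      · ext i
        simp [SPD.edges]
      · rw [Set.compl_inter, compl_compl, compl_compl]
    · rw [cone_union, SPD.arrangement, e, e']

theorem SPD.arrangement_congr {s s' : ι → ℤˣ} (Δ : SPD ι) (h : ∀ i ∈ Δ.edges, s i = s' i) :
    Δ.arrangement s = Δ.arrangement s' := by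
  induction Δ with
  | edge i => simp [SPD.arrangement, h i (by simp [SPD.edges])]
  | series Δ₁ Δ₂ ih₁ ih₂ =>
    rw [SPD.arrangement, SPD.arrangement, ih₁ fun i hi => h i (by simp [SPD.edges, hi]),
      ih₂ fun i hi => h i (by simp [SPD.edges, hi])]
  | parallel Δ₁ Δ₂ ih₁ ih₂ =>
    rw [SPD.arrangement, SPD.arrangement, ih₁ fun i hi => h i (by simp [SPD.edges, hi]),
      ih₂ fun i hi => h i (by simp [SPD.edges, hi])]

/-- `cone S` is the arrangement of a signed diagram in which exactly the elements of `E` are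
labels, each of them once. -/
def IsDiagram (E : Set ι) (S : Set (ι → ℤˣ)) : Prop :=
  ∃ (Δ : SPD ι) (s : ι → ℤˣ), Δ.edges.Nodup ∧ (∀ i, i ∈ Δ.edges ↔ i ∈ E) ∧
    cone S = Δ.arrangement s

theorem ReadOnce.isDiagram {E : Set ι} {S : Set (ι → ℤˣ)} (h : ReadOnce E S) :
    IsDiagram E S ∧ IsDiagram E Sᶜ := by
  induction h with
  | edge i e =>
    refine ⟨⟨.edge i, fun _ => e, by simp [SPD.edges], by simp [SPD.edges], cone_edge i e⟩,
      ⟨.edge i, fun _ => -e, by simp [SPD.edges], by simp [SPD.edges], ?_⟩⟩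
    rw [SPD.arrangement, ← cone_edge]
    congr 1
    ext t
    rcases Int.units_eq_one_or (t i) with h1 | h1 <;> rcases Int.units_eq_one_or e with h2 | h2 <;>
      simp [h1, h2]
  | compl _ ih => exact ⟨ih.2, by simpa using ih.1⟩
  | @inter A B S T hd h₁ h₂ ih₁ ih₂ =>
    constructor
    · obtain ⟨Δ₁, s₁, n₁, e₁, c₁⟩ := ih₁.1
      obtain ⟨Δ₂, s₂, n₂, e₂, c₂⟩ := ih₂.1
      refine ⟨.series Δ₁ Δ₂, A.piecewise s₁ s₂, ?_, ?_, ?_⟩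
      · rw [SPD.edges, List.nodup_append']
        exact ⟨n₁, n₂, fun i hi hi' => hd.notMem_of_mem_left ((e₁ i).1 hi) ((e₂ i).1 hi')⟩
      · intro i
        simp [SPD.edges, e₁, e₂]
      · rw [cone_inter_of_disjoint hd h₁.supportedOn h₂.supportedOn, c₁, c₂, SPD.arrangement]
        congr 1
        · exact Δ₁.arrangement_congr fun i hi => by simp [(e₁ i).1 hi]
        · exact Δ₂.arrangement_congr fun i hi => by
            simp [hd.notMem_of_mem_right ((e₂ i).1 hi)]
    · obtain ⟨Δ₁, s₁, n₁, e₁, c₁⟩ := ih₁.2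
      obtain ⟨Δ₂, s₂, n₂, e₂, c₂⟩ := ih₂.2
      refine ⟨.parallel Δ₁ Δ₂, A.piecewise s₁ s₂, ?_, ?_, ?_⟩
      · rw [SPD.edges, List.nodup_append']
        exact ⟨n₁, n₂, fun i hi hi' => hd.notMem_of_mem_left ((e₁ i).1 hi) ((e₂ i).1 hi')⟩
      · intro i
        simp [SPD.edges, e₁, e₂]
      · rw [Set.compl_inter, cone_union, c₁, c₂, SPD.arrangement]
        congr 1
        · exact Δ₁.arrangement_congr fun i hi => by simp [(e₁ i).1 hi]
        · exact Δ₂.arrangement_congr fun i hi => by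
            simp [hd.notMem_of_mem_right ((e₂ i).1 hi)]

theorem cone_univ : cone (Set.univ : Set (ι → ℤˣ)) = Set.univ :=
  Set.eq_univ_of_forall fun x => mem_cone.2 ⟨signVec x, trivial, fun _ _ => rfl⟩

theorem isFloralArrangement_cone_iff {E : Set ι} {S : Set (ι → ℤˣ)} :
    IsFloralArrangement E (cone S) ↔ Floral E S := by
  constructor
  · rintro (⟨rfl, h⟩ | ⟨Δ, s, hn, he, h⟩)
    · exact Or.inl ⟨rfl, cone_injective (h.trans cone_univ.symm)⟩
    · obtain ⟨T, hT, hΔ⟩ := Δ.exists_readOnce s hn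
      obtain rfl : S = T := cone_injective (h.trans hΔ)
      obtain rfl : {i | i ∈ Δ.edges} = E := Set.ext he
      exact Or.inr hT
  · rintro (⟨rfl, rfl⟩ | h)
    · exact Or.inl ⟨rfl, cone_univ⟩
    · exact Or.inr h.isDiagram.1

/-! ### Tangent cones -/

/-- The sign vectors pointing from `v` into `P`. -/
def germ (P : Set (ι → ℝ)) (v : ι → ℝ) : Set (ι → ℤˣ) :=
  {t | ∀ᶠ ε : ℝ in 𝓝[>] 0, v + ε • toVec t ∈ P}

/-- `cone S` is the tangent cone of `P` at `v`. -/
def HasGerm (P : Set (ι → ℝ)) (v : ι → ℝ) (S : Set (ι → ℤˣ)) : Prop :=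
  ∀ᶠ w in 𝓝 v, (w ∈ P ↔ w - v ∈ cone S)

theorem HasGerm.germ_eq {P : Set (ι → ℝ)} {v : ι → ℝ} {S : Set (ι → ℤˣ)}
    (h : HasGerm P v S) : germ P v = S := by
  ext t
  have hc : Tendsto (fun ε : ℝ => v + ε • toVec t) (𝓝[>] 0) (𝓝 v) := by
    have : Continuous fun ε : ℝ => v + ε • toVec t := by fun_prop
    simpa using (this.tendsto 0).mono_left nhdsWithin_le_nhds
  have : ∀ᶠ ε : ℝ in 𝓝[>] 0, (v + ε • toVec t ∈ P ↔ t ∈ S) := by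
    filter_upwards [hc.eventually h, self_mem_nhdsWithin] with ε h1 h2
    rw [h1, add_sub_cancel_left, smul_toVec_mem_cone h2]
  change (∀ᶠ ε : ℝ in 𝓝[>] 0, v + ε • toVec t ∈ P) ↔ _
  rw [eventually_congr this, eventually_const]

theorem HasGerm.localize [Finite ι] {P : Set (ι → ℝ)} {v : ι → ℝ} {S : Set (ι → ℤˣ)}
    (h : HasGerm P v S) : ∀ᶠ w in 𝓝 v, HasGerm P w (localize S (w - v)) := by
  filter_upwards [h.eventually_nhds] with w hw
  have h2 : Tendsto (fun z => z - v) (𝓝 w) (𝓝 (w - v)) :=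
    (continuous_id.sub continuous_const).tendsto w
  filter_upwards [hw, h2.eventually (eventually_mem_cone_iff S (w - v))] with z h3 h4
  rw [h3, h4, sub_sub_sub_cancel_right]

theorem isTangentCone_iff [Fintype ι] {P : Set (ι → ℝ)} {v : ι → ℝ} {α : Set (ι → ℝ)} :
    IsTangentCone P v α ↔ ∃ S, α = cone S ∧ HasGerm P v S := by
  have key : ∀ α : Set (ι → ℝ), (∀ᶠ w in 𝓝 v, (w ∈ P ↔ w - v ∈ α)) ↔
      ∃ δ : ℝ, 0 < δ ∧ ∀ x : ι → ℝ, (∀ i, |x i| ≤ δ) → (v + x ∈ P ↔ x ∈ α) := by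
    intro α
    rw [Metric.nhds_basis_closedBall.eventually_iff]
    refine exists_congr fun δ => and_congr_right fun hδ => ?_
    constructor
    · intro h x hx
      have := @h (v + x) (by
        rw [mem_closedBall_iff_norm, add_sub_cancel_left, pi_norm_le_iff_of_nonneg hδ.le]
        exact hx)
      rwa [add_sub_cancel_left] at this
    · intro h w hw
      rw [mem_closedBall_iff_norm, pi_norm_le_iff_of_nonneg hδ.le] at hw
      simpa using h (w - v) hw
  constructor
  · rintro ⟨⟨S, rfl⟩, h⟩
    exact ⟨S, rfl, (key _).2 h⟩
  · rintro ⟨S, rfl, h⟩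
    exact ⟨⟨S, rfl⟩, (key _).1 h⟩

/-- `P` has a tangent cone at every point. -/
def HasGerms (P : Set (ι → ℝ)) : Prop := ∀ v, HasGerm P v (germ P v)

theorem HasGerm.union {P Q : Set (ι → ℝ)} {v : ι → ℝ} {S T : Set (ι → ℤˣ)}
    (hP : HasGerm P v S) (hQ : HasGerm Q v T) : HasGerm (P ∪ Q) v (S ∪ T) := by
  filter_upwards [hP, hQ] with w h1 h2
  rw [cone_union, Set.mem_union, Set.mem_union, h1, h2]

theorem cone_empty : cone (∅ : Set (ι → ℤˣ)) = ∅ := by simp [cone]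

theorem hasGerm_of_notMem {P : Set (ι → ℝ)} (hP : IsClosed P) {v : ι → ℝ} (hv : v ∉ P) :
    HasGerm P v ∅ := by
  filter_upwards [hP.isOpen_compl.mem_nhds hv] with w hw
  rw [cone_empty]
  exact iff_of_false hw (Set.notMem_empty _)

theorem exists_hasGerm_Icc [Finite ι] {a b : ι → ℝ} (hab : ∀ i, a i < b i) (v : ι → ℝ) :
    ∃ S, HasGerm (Set.Icc a b) v S := by
  by_cases hv : v ∈ Set.Icc a b
  swap
  · exact ⟨∅, hasGerm_of_notMem isClosed_Icc hv⟩
  refine ⟨{s | ∀ i, (v i = a i → s i = 1) ∧ (v i = b i → s i = -1)}, ?_⟩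
  have ev : ∀ᶠ w in 𝓝 v, ∀ i, (a i < v i → a i < w i) ∧ (v i < b i → w i < b i) := by
    rw [eventually_all]
    intro i
    have hc : Tendsto (fun y : ι → ℝ => y i) (𝓝 v) (𝓝 (v i)) := (continuous_apply i).tendsto v
    refine Eventually.and ?_ ?_
    · by_cases h : a i < v i
      · filter_upwards [hc.eventually_const_lt h] with w hw _ using hw
      · exact Eventually.of_forall fun w h' => absurd h' h
    · by_cases h : v i < b i
      · filter_upwards [hc.eventually_lt_const h] with w hw _ using hw
      · exact Eventually.of_forall fun w h' => absurd h' h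
  filter_upwards [ev] with w hw
  rw [mem_cone]
  constructor
  · intro h
    refine ⟨fun i => if v i = a i then 1 else if v i = b i then -1 else signVec (w - v) i,
      fun i => ⟨fun hi => by simp [hi], fun hi => ?_⟩, fun i hi => ?_⟩
    · have : v i ≠ a i := hi ▸ (hab i).ne'
      simp [hi, (hab i).ne']
    · have h1 := h.1 i
      have h2 := h.2 i
      dsimp only
      split_ifs with c1 c2
      · simp [signVec, c1, h1]
      · have : ¬ (b i ≤ w i) := by
          intro h3
          exact hi (by simp [c2, le_antisymm h2 h3])
        simp [signVec, c2, this]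
      · rfl
  · rintro ⟨s, hs, h⟩
    constructor
    · intro i
      rcases (hv.1 i).lt_or_eq with h1 | h1
      · exact ((hw i).1 h1).le
      · by_contra h2
        have h3 : w i < v i := h1 ▸ not_le.1 h2
        have := h i (by simpa [sub_eq_zero] using h3.ne)
        rw [(hs i).1 h1.symm] at this
        simp [signVec, h3] at this
    · intro i
      rcases (hv.2 i).lt_or_eq with h1 | h1
      · exact ((hw i).2 h1).le
      · by_contra h2
        have h3 : v i < w i := h1 ▸ not_le.1 h2
        have := h i (by simpa [sub_eq_zero] using h3.ne')
        rw [(hs i).2 h1] at this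
        simp [signVec, h3.le] at this

theorem IsPureOrthogonalPolytope.hasGerms [Finite ι] {P : Set (ι → ℝ)}
    (hP : IsPureOrthogonalPolytope P) : HasGerms P := by
  intro v
  suffices h : ∃ S, HasGerm P v S by
    obtain ⟨S, hS⟩ := h
    rwa [hS.germ_eq]
  obtain ⟨B, hB, rfl⟩ := hP
  induction B using Finset.induction_on with
  | empty =>
    refine ⟨∅, ?_⟩
    simpa using hasGerm_of_notMem isClosed_empty (Set.notMem_empty v)
  | insert b B _ ih =>
    obtain ⟨S, hS⟩ := ih fun b hb => hB b (Finset.mem_insert_of_mem hb)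
    obtain ⟨T, hT⟩ := exists_hasGerm_Icc (hB b (Finset.mem_insert_self b B)) v
    refine ⟨T ∪ S, ?_⟩
    rw [Finset.set_biUnion_insert]
    exact hT.union hS

theorem IsPureOrthogonalPolytope.isCompact {P : Set (ι → ℝ)}
    (hP : IsPureOrthogonalPolytope P) : IsCompact P := by
  obtain ⟨B, -, rfl⟩ := hP
  exact B.finite_toSet.isCompact_biUnion fun b _ => isCompact_Icc

theorem HasGerms.mem_iff {P : Set (ι → ℝ)} (hP : HasGerms P) {v : ι → ℝ} :
    v ∈ P ↔ (germ P v).Nonempty := by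
  rw [(hP v).self_of_nhds, sub_self, mem_cone]
  simp [Set.Nonempty]

theorem HasGerms.eventually_germ_eq [Finite ι] {P : Set (ι → ℝ)} (hP : HasGerms P) (v : ι → ℝ) :
    ∀ᶠ w in 𝓝 v, germ P w = localize (germ P v) (w - v) :=
  (hP v).localize.mono fun _ h => h.germ_eq

theorem localize_eq_self [Finite ι] {S : Set (ι → ℤˣ)} {x : ι → ℝ}
    (h : ∀ i ∈ essential S, x i = 0) : localize S x = S := by
  ext s
  refine mem_iff_of_eqOn_essential (s := Set.piecewise {i | x i = 0} s _) fun i hi => ?_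
  exact Set.piecewise_eq_of_mem _ _ _ (h i hi)

/-! ### Genericity regions -/

theorem Congruent.refl (α : Set (ι → ℝ)) : Congruent α α :=
  ⟨1, 1, by simp⟩

theorem Congruent.ncard_essential_eq {S T : Set (ι → ℤˣ)} (h : Congruent (cone S) (cone T)) :
    (essential S).ncard = (essential T).ncard := by
  obtain ⟨f, s, h⟩ := h
  have key : ∀ t, (fun i => s i * t (f i)) ∈ T ↔ t ∈ S := by
    intro t
    have e : toVec (fun i => s i * t (f i)) = fun i => ((s i : ℤ) : ℝ) * toVec t (f i) := by
      ext i
      simp [toVec]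
    rw [← toVec_mem_cone, ← toVec_mem_cone (S := S), h, e]
    refine Function.Injective.mem_set_image (f := fun (x : ι → ℝ) i =>
      ((s i : ℤ) : ℝ) * x (f i)) fun x y hxy => ?_
    ext i
    have := congrFun hxy (f.symm i)
    simpa using this
  have : essential T = f ⁻¹' essential S := by
    ext j
    have flip : ∀ t : ι → ℤˣ, Function.update (fun i => s i * t (f i)) j (-(s j * t (f j))) =
        fun i => s i * Function.update t (f j) (-(t (f j))) (f i) := by
      intro t
      ext1 i
      rcases eq_or_ne i j with rfl | hij
      · simp
      · simp [hij]
    constructor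
    · rintro ⟨t, ht, ht'⟩
      obtain ⟨t, rfl⟩ : ∃ t' : ι → ℤˣ, t = fun i => s i * t' (f i) := by
        refine ⟨fun i => s (f.symm i) * t (f.symm i), ?_⟩
        ext1 i
        simp [← mul_assoc]
      exact ⟨t, (key t).1 ht, fun h => ht' (by rw [flip]; exact (key _).2 h)⟩
    · rintro ⟨t, ht, ht'⟩
      refine ⟨_, (key t).2 ht, fun h => ht' ?_⟩
      rw [flip] at h
      exact (key _).1 h
  rw [this, Set.ncard_preimage_of_injective_subset_range f.injective (by simp)]

theorem HasGerms.congruentAt_iff [Fintype ι] {P : Set (ι → ℝ)} (hP : HasGerms P) {v w : ι → ℝ} :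
    CongruentAt P v w ↔ Congruent (cone (germ P v)) (cone (germ P w)) := by
  constructor
  · rintro ⟨α, β, hα, hβ, h⟩
    obtain ⟨S, rfl, hS⟩ := isTangentCone_iff.1 hα
    obtain ⟨T, rfl, hT⟩ := isTangentCone_iff.1 hβ
    rwa [hS.germ_eq, hT.germ_eq]
  · exact fun h => ⟨_, _, isTangentCone_iff.2 ⟨_, rfl, hP v⟩, isTangentCone_iff.2 ⟨_, rfl, hP w⟩, h⟩

/-- Near `u`, the tangent cone can only be congruent to the one at `u` by being equal to it. -/
theorem HasGerms.eventually_eq_of_ncard_le [Finite ι] {P : Set (ι → ℝ)} (hP : HasGerms P)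
    (u : ι → ℝ) : ∀ᶠ w in 𝓝 u, (essential (germ P u)).ncard ≤ (essential (germ P w)).ncard →
      germ P w = germ P u ∧ ∀ i ∈ essential (germ P u), w i = u i := by
  filter_upwards [hP.eventually_germ_eq u] with w hw h
  rw [hw] at h ⊢
  obtain ⟨h1, h2⟩ := restr_eq_self h
  exact ⟨h2, fun i hi => sub_eq_zero.1 (h1 hi)⟩

theorem HasGerms.eventually_germ_eq_self [Finite ι] {P : Set (ι → ℝ)} (hP : HasGerms P)
    (u : ι → ℝ) : ∀ᶠ w in 𝓝 u, (∀ i ∈ essential (germ P u), w i = u i) →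
      germ P w = germ P u := by
  filter_upwards [hP.eventually_germ_eq u] with w hw h
  rw [hw]
  exact localize_eq_self fun i hi => sub_eq_zero.2 (h i hi)

/-- Along a genericity region, the tangent cone and its essential coordinates are constant. -/
theorem HasGerms.eq_of_mem_genericityRegion [Fintype ι] {P : Set (ι → ℝ)} (hP : HasGerms P)
    {v w : ι → ℝ} (hw : w ∈ genericityRegion P v) :
    germ P w = germ P v ∧ ∀ i ∈ essential (germ P v), w i = v i := by
  obtain ⟨γ, hγ⟩ := hw
  let g : (ι → ℝ) → Set (ι → ℤˣ) × (ι → ℝ) := fun u =>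
    (germ P u, (essential (germ P u)).piecewise u 0)
  have hloc : IsLocallyConstant fun t => g (γ t) := by
    rw [IsLocallyConstant.iff_eventually_eq]
    intro t
    filter_upwards [(γ.continuous.tendsto t).eventually (hP.eventually_eq_of_ncard_le (γ t))]
      with t' ht'
    have h1 := (hP.congruentAt_iff.1 (hγ t).2).ncard_essential_eq
    have h2 := (hP.congruentAt_iff.1 (hγ t').2).ncard_essential_eq
    obtain ⟨h3, h4⟩ := ht' (h1.symm.trans h2).le
    refine Prod.ext h3 ?_
    change Set.piecewise _ _ _ = Set.piecewise _ _ _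
    rw [h3]
    ext i
    by_cases hi : i ∈ essential (germ P (γ t))
    · simp [hi, h4 i hi]
    · simp [hi]
  have := hloc.apply_eq_of_preconnectedSpace 1 0
  simp only [γ.target, γ.source, g, Prod.mk.injEq] at this
  refine ⟨this.1, fun i hi => ?_⟩
  have h2 := congrFun this.2 i
  rw [this.1] at h2
  simpa [hi] using h2

theorem mem_genericityRegion_self [Fintype ι] {P : Set (ι → ℝ)} (hP : HasGerms P) {v : ι → ℝ}
    (hv : v ∈ P) : v ∈ genericityRegion P v :=
  JoinedIn.refl ⟨hv, hP.congruentAt_iff.2 (.refl _)⟩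

theorem genericityRegion_subset (P : Set (ι → ℝ)) (v : ι → ℝ) : genericityRegion P v ⊆ P :=
  fun _ hw => hw.target_mem.1

theorem HasGerms.mem_genericityRegion_of_segment [Fintype ι] {P : Set (ι → ℝ)} (hP : HasGerms P)
    {v w z : ι → ℝ} (hw : w ∈ genericityRegion P v)
    (h : ∀ x ∈ segment ℝ w z, germ P x = germ P v) : z ∈ genericityRegion P v := by
  refine JoinedIn.trans hw (JoinedIn.of_segment_subset fun x hx => ?_)
  refine ⟨?_, hP.congruentAt_iff.2 ?_⟩
  · rw [hP.mem_iff, h x hx, ← hP.mem_iff]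
    exact hw.source_mem.1
  · rw [h x hx]
    exact .refl _

/-- A genericity region is open in the hyperplane of its essential coordinates. -/
theorem HasGerms.eventually_mem_genericityRegion [Fintype ι] {P : Set (ι → ℝ)} (hP : HasGerms P)
    {v u : ι → ℝ} (hu : u ∈ genericityRegion P v) :
    ∀ᶠ w in 𝓝 u, (∀ i ∈ essential (germ P v), w i = u i) → w ∈ genericityRegion P v := by
  have hg := (hP.eq_of_mem_genericityRegion hu).1
  obtain ⟨ε, hε, h⟩ := Metric.eventually_nhds_iff_ball.1 (hP.eventually_germ_eq_self u)
  filter_upwards [Metric.ball_mem_nhds u hε] with w hw hwu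
  refine hP.mem_genericityRegion_of_segment hu fun x hx => ?_
  rw [← hg]
  refine h x ((convex_ball u ε).segment_subset (Metric.mem_ball_self hε) hw hx) fun i hi => ?_
  rw [hg] at hi
  obtain ⟨a, b, -, -, hab, rfl⟩ := hx
  rw [Pi.add_apply, Pi.smul_apply, Pi.smul_apply, hwu i hi, ← add_smul, hab, one_smul]

theorem HasGerms.degree_genericityRegion [Fintype ι] {P : Set (ι → ℝ)} (hP : HasGerms P)
    {v : ι → ℝ} (hv : v ∈ P) :
    degree (genericityRegion P v) = Nat.card ((essential (germ P v))ᶜ : Set ι) := by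
  refine le_antisymm (Nat.sInf_le ⟨essential (germ P v), fun i => v i, fun w hw i => ?_, rfl⟩) ?_
  · exact (hP.eq_of_mem_genericityRegion hw).2 i i.2
  refine le_csInf ⟨_, ∅, fun i => v i, fun w hw i => i.2.elim, rfl⟩ ?_
  rintro n ⟨I, l, hI, rfl⟩
  refine Nat.card_mono (Set.toFinite _) (Set.compl_subset_compl.2 fun i hi => ?_)
  by_contra hE
  -- Otherwise the region contains a point whose `i`-th coordinate differs from that of `v`.
  have hc : Tendsto (fun ε : ℝ => v + ε • Pi.single i 1) (𝓝[>] 0) (𝓝 v) := by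
    have : Continuous fun ε : ℝ => v + ε • (Pi.single i 1 : ι → ℝ) := by fun_prop
    simpa using (this.tendsto 0).mono_left nhdsWithin_le_nhds
  have hself := mem_genericityRegion_self hP hv
  obtain ⟨ε, h1, h2⟩ := ((hc.eventually (hP.eventually_mem_genericityRegion hself)).and
    self_mem_nhdsWithin).exists
  have h3 := hI (h1 fun j hj => by
    have : j ≠ i := by rintro rfl; exact hE hj
    simp [this]) ⟨i, hi⟩
  have h4 := hI hself ⟨i, hi⟩
  rw [← h4] at h3
  simp only [Pi.add_apply, Pi.smul_apply, Pi.single_eq_same, smul_eq_mul, mul_one,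
    add_eq_left] at h3
  exact (ne_of_gt h2) h3

theorem HasGerms.isSingularPoint_iff [Fintype ι] {P : Set (ι → ℝ)} (hP : HasGerms P)
    {v : ι → ℝ} : IsSingularPoint P v ↔ v ∈ P ∧ essential (germ P v) = Set.univ := by
  refine and_congr_right fun hv => ?_
  rw [hP.degree_genericityRegion hv, Finite.card_eq_zero_iff, Set.isEmpty_coe_sort,
    Set.compl_empty_iff]

/-! ### Tangent cones of a generic orthotope -/

/-- If the tangent cone at `v` does not depend on all coordinates, there is a point of `P` whose
tangent cone depends on more coordinates, and degenerates to the tangent cone at `v`. It is found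
by moving as far as possible in the direction of an inessential coordinate. -/
theorem HasGerms.exists_germ_eq_localize [Finite ι] {P : Set (ι → ℝ)} (hP : HasGerms P)
    (hc : IsCompact P) {v : ι → ℝ} (hv : v ∈ P) (hE : essential (germ P v) ≠ Set.univ) :
    ∃ u ∈ P, ∃ x, germ P v = localize (germ P u) x ∧
      (essential (germ P v)).ncard < (essential (germ P u)).ncard := by
  obtain ⟨i, hi⟩ := (Set.ne_univ_iff_exists_notMem _).1 hE
  let T := {w | germ P w = germ P v}
  have hTP : T ⊆ P := fun w hw => by
    rw [hP.mem_iff, show germ P w = germ P v from hw, ← hP.mem_iff]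
    exact hv
  have hcT : closure T ⊆ P := closure_minimal hTP hc.isClosed
  obtain ⟨u, hu, hmax⟩ := (hc.of_isClosed_subset isClosed_closure hcT).exists_isMaxOn
    ⟨v, subset_closure (show v ∈ T from rfl)⟩ (continuous_apply i).continuousOn
  have huT : germ P u ≠ germ P v := by
    intro h
    have hc : Tendsto (fun ε : ℝ => u + ε • Pi.single i 1) (𝓝[>] 0) (𝓝 u) := by
      have : Continuous fun ε : ℝ => u + ε • (Pi.single i 1 : ι → ℝ) := by fun_prop
      simpa using (this.tendsto 0).mono_left nhdsWithin_le_nhds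
    obtain ⟨ε, h1, h2⟩ := ((hc.eventually (hP.eventually_germ_eq_self u)).and
      self_mem_nhdsWithin).exists
    have h3 : u + ε • Pi.single i 1 ∈ T := by
      refine Eq.trans (h1 fun j hj => ?_) h
      have : j ≠ i := by rintro rfl; exact hi (h ▸ hj)
      simp [this]
    have h4 : (u + ε • Pi.single i 1 : ι → ℝ) i ≤ u i := hmax (subset_closure h3)
    simp only [Pi.add_apply, Pi.smul_apply, Pi.single_eq_same, smul_eq_mul, mul_one] at h4
    have h2' : (0 : ℝ) < ε := h2
    linarith
  obtain ⟨w, hw, h1, h2⟩ := (mem_closure_iff_frequently.1 hu).and_eventually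
    ((hP.eventually_germ_eq u).and (hP.eventually_eq_of_ncard_le u)) |>.exists
  have hw' : germ P w = germ P v := hw
  rw [hw'] at h1 h2
  exact ⟨u, hcT hu, _, h1, not_le.1 fun h => huT (h2 h).1.symm⟩

/-- All tangent cones of a generic orthotope are floral, not only those at its singular points:
they arise from the latter by repeated degeneration. -/
theorem IsGenericOrthotope.exists_floral [Fintype ι] {P : Set (ι → ℝ)}
    (hP : IsGenericOrthotope P) {v : ι → ℝ} (hv : v ∈ P) : ∃ D, Floral D (germ P v) := by
  have hg := hP.1.hasGerms
  induction hn : Fintype.card ι - (essential (germ P v)).ncard using Nat.strong_induction_on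
    generalizing v with
  | _ n ih =>
    by_cases hE : essential (germ P v) = Set.univ
    · obtain ⟨α, h1, h2⟩ := hP.2 v (hg.isSingularPoint_iff.2 ⟨hv, hE⟩)
      obtain ⟨S, rfl, hS⟩ := isTangentCone_iff.1 h1
      rw [hS.germ_eq]
      exact ⟨_, isFloralArrangement_cone_iff.1 h2⟩
    · obtain ⟨u, hu, x, h1, h2⟩ := hg.exists_germ_eq_localize hP.1.isCompact hv hE
      have h3 : (essential (germ P u)).ncard ≤ Fintype.card ι := by
        rw [← Nat.card_eq_fintype_card]
        exact Set.ncard_le_card _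
      obtain ⟨D, hD⟩ := ih _ (by omega) hu rfl
      have h4 := hg.mem_iff.1 hv
      rw [h1] at h4 ⊢
      exact hD.exists_floral_restr h4

/-! ### Local structure of faces -/

/-- Any point of a genericity region can be moved within the region to a nearby point which has no
inessential coordinate in common with `u`. -/
theorem HasGerms.exists_mem_genericityRegion_ne [Fintype ι] {P : Set (ι → ℝ)} (hP : HasGerms P)
    {v w : ι → ℝ} (hw : w ∈ genericityRegion P v) (u : ι → ℝ) {U : Set (ι → ℝ)} (hU : U ∈ 𝓝 w) :
    ∃ z ∈ U, z ∈ genericityRegion P v ∧ ∀ i ∉ essential (germ P v), z i ≠ u i := by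
  let y : ι → ℝ := (essential (germ P v)).piecewise 0 1
  have hc : Tendsto (fun ε : ℝ => w + ε • y) (𝓝[>] 0) (𝓝 w) := by
    have : Continuous fun ε : ℝ => w + ε • y := by fun_prop
    simpa using (this.tendsto 0).mono_left nhdsWithin_le_nhds
  have hne : ∀ᶠ ε : ℝ in 𝓝[>] 0, ∀ i, ε ≠ u i - w i := by
    rw [eventually_all]
    intro i
    rcases eq_or_ne (u i - w i) 0 with h | h
    · filter_upwards [self_mem_nhdsWithin] with ε hε
      rw [h]
      exact (ne_of_gt hε)
    · exact (eventually_ne_nhds h.symm).filter_mono nhdsWithin_le_nhds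
  obtain ⟨ε, ⟨h1, h2⟩, h3⟩ := ((hc.eventually
    (Filter.Eventually.and hU (hP.eventually_mem_genericityRegion hw))).and hne).exists
  refine ⟨_, h1, h2 fun i hi => by simp [y, hi], fun i hi h => h3 i ?_⟩
  simp only [y, Pi.add_apply, Pi.smul_apply, smul_eq_mul, Set.piecewise_eq_of_notMem _ _ _ hi,
    Pi.one_apply, mul_one] at h
  linarith

theorem eq_of_mem_closure_genericityRegion [Fintype ι] {P : Set (ι → ℝ)} (hP : HasGerms P)
    {v w : ι → ℝ} (hw : w ∈ closure (genericityRegion P v)) :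
    ∀ i ∈ essential (germ P v), w i = v i := by
  intro i hi
  have : IsClosed {w : ι → ℝ | w i = v i} := isClosed_eq (continuous_apply i) continuous_const
  exact closure_minimal (fun w hw => (hP.eq_of_mem_genericityRegion hw).2 i hi) this hw

theorem signVec_eq_of_pos {t : ι → ℤˣ} {x : ι → ℝ} {i : ι} (h : 0 < toVec t i * x i) :
    x i ≠ 0 ∧ signVec x i = t i := by
  have h0 : x i ≠ 0 := by
    intro h0
    simp [h0] at h
  exact ⟨h0, ((sign_mul_nonneg_iff (t i) x i).1 h.le h0).symm⟩

theorem toVec_signVec_mul_pos {x : ι → ℝ} {i : ι} (h : x i ≠ 0) :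
    0 < toVec (signVec x) i * x i := by
  refine lt_of_le_of_ne ((sign_mul_nonneg_iff _ x i).2 fun _ => rfl) ?_
  exact (mul_ne_zero (toVec_ne_zero _ i) h).symm

theorem toVec_mul_self (t : ι → ℤˣ) (i : ι) : toVec t i * toVec t i = 1 := by
  rcases Int.units_eq_one_or (t i) with h | h <;> simp [toVec, h]

theorem units_eq_or_eq_of_ne {a b : ℤˣ} (h : a ≠ b) (c : ℤˣ) : c = a ∨ c = b := by
  revert a b c
  decide

theorem piecewise_piecewise_of_subset {E Z : Set ι} (hEZ : E ⊆ Z) (s t r : ι → ℤˣ) :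
    E.piecewise s (E.piecewise r (Z.piecewise s t)) = Z.piecewise s t := by
  ext1 i
  by_cases hE : i ∈ E
  · simp [hE, hEZ hE]
  · by_cases hZ : i ∈ Z <;> simp [hE, hZ]

/-- Near a point `u` of the closure of the genericity region `R` of `v`, this closure is the
arrangement, inside the hyperplane of essential coordinates, of those sign vectors at which the
tangent cone at `u` degenerates to the tangent cone at `v`.

The points near `u` with these signs all belong to the single region `R`, because the set of these
sign vectors is unate: from each such point there is a segment into the orthant of the
distinguished sign vector `e` along which the tangent cone does not change. -/
theorem HasGerms.eventually_mem_closure_iff [Fintype ι] {P : Set (ι → ℝ)} (hP : HasGerms P)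
    {u v : ι → ℝ} (hu : u ∈ closure (genericityRegion P v)) {D : Set ι}
    (hD : Floral D (germ P u)) :
    Floral (D \ essential (germ P v)) {t | restr (essential (germ P v)) t (germ P u) = germ P v} ∧
    ∀ᶠ w in 𝓝 u, (w ∈ closure (genericityRegion P v) ↔
      (∀ i ∈ essential (germ P v), w i = u i) ∧
        w - u ∈ cone {t | restr (essential (germ P v)) t (germ P u) = germ P v}) := by
  set E := essential (germ P v) with hE
  set G := {t | restr E t (germ P u) = germ P v} with hG
  set R := genericityRegion P v with hR
  obtain ⟨ε, hε, hball⟩ := Metric.eventually_nhds_iff_ball.1 (hP.eventually_germ_eq u)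
  have huE : ∀ i ∈ E, u i = v i := eq_of_mem_closure_genericityRegion hP hu
  have hGoff : ∀ t t', (∀ i ∉ E, t i = t' i) → (t ∈ G ↔ t' ∈ G) := by
    intro t t' h
    have : restr E t (germ P u) = restr E t' (germ P u) :=
      restr_congr (A := Set.univ) (fun s s' h => by rw [funext fun i => h i trivial])
        fun i _ => ⟨Iff.rfl, h i⟩
    change _ = _ ↔ _ = _
    rw [this]
  -- Near `u`, the signs of generic points of `R` lie in `G`.
  have hRG : ∀ z ∈ Metric.ball u ε, z ∈ R → (∀ i ∉ E, z i ≠ u i) → signVec (z - u) ∈ G := by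
    intro z hz hzR hzg
    have hzE := (hP.eq_of_mem_genericityRegion hzR)
    have : {i | (z - u) i = 0} = E := by
      ext i
      by_cases hi : i ∈ E
      · simp [hi, hzE.2 i hi, huE i hi]
      · simpa [hi, sub_eq_zero] using hzg i hi
    have h := hball z hz
    rw [localize, this, hzE.1] at h
    exact h.symm
  obtain ⟨w₀, hw₀, hw₀R, hw₀g⟩ : ∃ z ∈ Metric.ball u ε, z ∈ R ∧ ∀ i ∉ E, z i ≠ u i := by
    obtain ⟨r, hr, hrR⟩ := mem_closure_iff.1 hu _ Metric.isOpen_ball (Metric.mem_ball_self hε)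
    exact hP.exists_mem_genericityRegion_ne hrR u (Metric.isOpen_ball.mem_nhds hr)
  have hw₀G := hRG w₀ hw₀ hw₀R hw₀g
  have hv : v ∈ P := JoinedIn.source_mem hw₀R |>.1
  have hfl := hD.floral_restr_eq (hP.mem_iff.1 hv) ⟨_, hw₀G⟩
  refine ⟨hfl, ?_⟩
  obtain ⟨e, he⟩ := hfl.exists_monotone
  let p : ι → ℝ := u + (ε / 2) • E.piecewise (0 : ι → ℝ) (toVec e)
  have hp : p ∈ Metric.ball u ε := by
    rw [mem_ball_iff_norm, add_sub_cancel_left]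
    refine ((pi_norm_le_iff_of_nonneg (by positivity)).2 fun i => ?_).trans_lt (half_lt_self hε)
    by_cases hi : i ∈ E
    · simp [hi, (half_pos hε).le]
    · rcases Int.units_eq_one_or (e i) with h | h <;> simp [hi, toVec, h, abs_of_pos hε]
  -- The tangent cone does not change along the segment from a point with signs in `G` to `p`.
  have hseg : ∀ z ∈ Metric.ball u ε, (∀ i ∈ E, z i = u i) → (∀ i ∉ E, z i ≠ u i) →
      signVec (z - u) ∈ G → ∀ q ∈ segment ℝ z p, germ P q = germ P v := by
    intro z hz hzE hzg hzG q hq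
    rw [hball q ((convex_ball u ε).segment_subset hz hp hq)]
    obtain ⟨a, b, ha, hb, hab, rfl⟩ := hq
    set q : ι → ℝ := a • z + b • p with hq
    have hqi : ∀ i, q i - u i = a * (z i - u i) + b * (p i - u i) := by
      intro i
      simp only [hq, Pi.add_apply, Pi.smul_apply, smul_eq_mul]
      linear_combination u i * hab
    have hqE : E ⊆ {i | (q - u) i = 0} := by
      intro i hi
      change q i - u i = 0
      rw [hqi, hzE i hi]
      simp [p, hi]
    -- If the signs of `z` and of `p` agree at `i`, then `q` has this sign, too.
    have hsame : ∀ i ∉ E, signVec (z - u) i = e i →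
        (q - u) i ≠ 0 ∧ signVec (q - u) i = signVec (z - u) i := by
      intro i hi hie
      refine signVec_eq_of_pos ?_
      have h1 : 0 < toVec (signVec (z - u)) i * (z i - u i) :=
        toVec_signVec_mul_pos (x := z - u) (sub_ne_zero.2 (hzg i hi))
      have h2 : toVec (signVec (z - u)) i * (p i - u i) = ε / 2 := by
        have h3 : toVec (signVec (z - u)) i = toVec e i := by simp [toVec, hie]
        rw [h3]
        simp only [p, Pi.add_apply, Pi.smul_apply, add_sub_cancel_left, smul_eq_mul,
          Set.piecewise_eq_of_notMem _ _ _ hi]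
        linear_combination (ε / 2) * toVec_mul_self e i
      change 0 < _ * (q i - u i)
      rw [hqi, mul_add, mul_left_comm, mul_left_comm _ b, h2]
      rcases ha.eq_or_lt with rfl | ha
      · have : b = 1 := by linarith
        rw [this]
        linarith
      · have := mul_pos ha h1
        positivity
    ext s
    have hs : E.piecewise (signVec (z - u)) (Set.piecewise {i | (q - u) i = 0} s
        (signVec (q - u))) ∈ G := by
      refine he _ hzG _ fun i => ?_
      by_cases hi : i ∈ E
      · simp [hi]
      rcases eq_or_ne (signVec (z - u) i) (e i) with h | h
      · obtain ⟨h1, h2⟩ := hsame i hi h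
        refine Or.inl ?_
        rw [Set.piecewise_eq_of_notMem _ _ _ hi,
          Set.piecewise_eq_of_notMem {i | (q - u) i = 0} _ _ h1, h2]
      · exact units_eq_or_eq_of_ne h _
    rw [← show restr E _ (germ P u) = germ P v from hs]
    change _ ∈ germ P u ↔ _ ∈ germ P u
    rw [piecewise_piecewise_of_subset hqE]
  have hpR : p ∈ R := hP.mem_genericityRegion_of_segment hw₀R (hseg w₀ hw₀
    (fun i hi => by rw [(hP.eq_of_mem_genericityRegion hw₀R).2 i hi, huE i hi]) hw₀g hw₀G)
  have hmem : ∀ z ∈ Metric.ball u ε, (∀ i ∈ E, z i = u i) → (∀ i ∉ E, z i ≠ u i) →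
      signVec (z - u) ∈ G → z ∈ R := by
    intro z hz hzE hzg hzG
    refine hP.mem_genericityRegion_of_segment hpR ?_
    rw [segment_symm]
    exact hseg z hz hzE hzg hzG
  filter_upwards [Metric.ball_mem_nhds u hε] with w hw
  constructor
  · intro hwR
    refine ⟨fun i hi => ?_, ?_⟩
    · rw [huE i hi]
      exact eq_of_mem_closure_genericityRegion hP hwR i hi
    have hcl : IsClosed {w : ι → ℝ | w - u ∈ cone G} :=
      (isClosed_cone G).preimage (continuous_id.sub continuous_const)
    rw [← Set.mem_ofPred_eq (p := fun w : ι → ℝ => w - u ∈ cone G), ← hcl.closure_eq,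
      mem_closure_iff]
    intro U hU hwU
    obtain ⟨r, hr, hrR⟩ := mem_closure_iff.1 hwR (U ∩ Metric.ball u ε)
      (hU.inter Metric.isOpen_ball) ⟨hwU, hw⟩
    obtain ⟨z, hz, hzR, hzg⟩ := hP.exists_mem_genericityRegion_ne hrR u
      ((hU.inter Metric.isOpen_ball).mem_nhds hr)
    exact ⟨z, hz.1, mem_cone.2 ⟨_, hRG z hz.2 hzR hzg, fun _ _ => rfl⟩⟩
  · rintro ⟨hwE, hwG⟩
    obtain ⟨t, ht, htw⟩ := mem_cone.1 hwG
    have hc : Tendsto (fun δ : ℝ => w + δ • E.piecewise (0 : ι → ℝ) (toVec t)) (𝓝[>] 0) (𝓝 w) := by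
      have : Continuous fun δ : ℝ => w + δ • E.piecewise (0 : ι → ℝ) (toVec t) := by fun_prop
      simpa using (this.tendsto 0).mono_left nhdsWithin_le_nhds
    refine mem_closure_of_tendsto hc ?_
    filter_upwards [hc.eventually (Metric.isOpen_ball.mem_nhds hw), self_mem_nhdsWithin]
      with δ h1 h2
    have h2 : 0 < δ := h2
    have hsgn : ∀ i ∉ E, (w + δ • E.piecewise (0 : ι → ℝ) (toVec t) - u) i ≠ 0 ∧
        signVec (w + δ • E.piecewise (0 : ι → ℝ) (toVec t) - u) i = t i := by
      intro i hi
      refine signVec_eq_of_pos ?_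
      have h3 : 0 ≤ toVec t i * (w - u) i := (sign_mul_nonneg_iff (t i) (w - u) i).2 (htw i)
      have h4 := toVec_mul_self t i
      have h5 : (w + δ • E.piecewise (0 : ι → ℝ) (toVec t) - u) i = (w - u) i + δ * toVec t i := by
        simp only [Pi.sub_apply, Pi.add_apply, Pi.smul_apply, smul_eq_mul,
          Set.piecewise_eq_of_notMem _ _ _ hi]
        ring
      rw [h5, mul_add, mul_left_comm, h4]
      linarith
    refine hmem _ h1 (fun i hi => by simp [hi, hwE i hi])
      (fun i hi => sub_ne_zero.1 (hsgn i hi).1) ?_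
    exact (hGoff _ _ fun i hi => (hsgn i hi).2).2 ht

/-! ### Compact sets with tangent cones -/

theorem exists_boxes_of_hasGerm [Fintype ι] {Q : Set (ι → ℝ)} {y : ι → ℝ}
    {S : Set (ι → ℤˣ)} (h : HasGerm Q y S) : ∃ N ∈ 𝓝 y, ∃ B : Finset ((ι → ℝ) × (ι → ℝ)),
      (∀ b ∈ B, ∀ i, b.1 i < b.2 i) ∧ Q ∩ N ⊆ ⋃ b ∈ B, Set.Icc b.1 b.2 ∧
        ⋃ b ∈ B, Set.Icc b.1 b.2 ⊆ Q := by
  obtain ⟨-, δ, hδ, h⟩ := isTangentCone_iff.2 ⟨S, rfl, h⟩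
  let box : (ι → ℤˣ) → (ι → ℝ) × (ι → ℝ) := fun s =>
    (fun i => if s i = 1 then y i else y i - δ, fun i => if s i = 1 then y i + δ else y i)
  have hbox : ∀ s z, z ∈ Set.Icc (box s).1 (box s).2 ↔
      (∀ i, |(z - y) i| ≤ δ) ∧ z - y ∈ orthant s := by
    intro s z
    rw [Set.mem_Icc, Pi.le_def, Pi.le_def, ← forall_and, orthant, Set.mem_ofPred_eq, ← forall_and]
    refine forall_congr' fun i => ?_
    rw [abs_le, Pi.sub_apply]
    rcases Int.units_eq_one_or (s i) with hs | hs
    · simp only [box, hs, if_true, Units.val_one, Int.cast_one, one_mul]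
      constructor
      · rintro ⟨h1, h2⟩
        exact ⟨⟨by linarith, by linarith⟩, by linarith⟩
      · rintro ⟨⟨h1, h2⟩, h3⟩
        exact ⟨by linarith, by linarith⟩
    · have : (-1 : ℤˣ) ≠ 1 := by decide
      simp only [box, hs, this, if_false, Units.val_neg, Units.val_one, Int.cast_neg,
        Int.cast_one, neg_mul, one_mul]
      constructor
      · rintro ⟨h1, h2⟩
        exact ⟨⟨by linarith, by linarith⟩, by linarith⟩
      · rintro ⟨⟨h1, h2⟩, h3⟩
        exact ⟨by linarith, by linarith⟩
  refine ⟨_, Metric.closedBall_mem_nhds y hδ, (Set.toFinite S).toFinset.image box, ?_, ?_, ?_⟩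
  · intro b hb i
    obtain ⟨s, -, rfl⟩ := Finset.mem_image.1 hb
    by_cases hs : s i = 1 <;> simp [box, hs, hδ]
  · rintro z ⟨hzQ, hz⟩
    rw [mem_closedBall_iff_norm, pi_norm_le_iff_of_nonneg hδ.le] at hz
    have := (h (z - y) hz).1 (by simpa using hzQ)
    obtain ⟨s, hs, hzs⟩ := Set.mem_iUnion₂.1 this
    refine Set.mem_iUnion₂.2 ⟨box s, Finset.mem_image_of_mem _ (by simpa using hs), ?_⟩
    exact (hbox s z).2 ⟨hz, hzs⟩
  · refine Set.iUnion₂_subset fun b hb z hz => ?_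
    obtain ⟨s, hs, rfl⟩ := Finset.mem_image.1 hb
    obtain ⟨h1, h2⟩ := (hbox s z).1 hz
    have := (h (z - y) h1).2 (Set.mem_iUnion₂.2 ⟨s, by simpa using hs, h2⟩)
    simpa using this

/-- A compact set with a tangent cone at each of its points is a pure orthogonal polytope. -/
theorem isPureOrthogonalPolytope_of_hasGerm [Fintype ι] {Q : Set (ι → ℝ)} (hQ : IsCompact Q)
    (h : ∀ y ∈ Q, ∃ S, HasGerm Q y S) : IsPureOrthogonalPolytope Q := by
  obtain ⟨B, h1, h2, h3⟩ := hQ.induction_on (p := fun N =>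
      ∃ B : Finset ((ι → ℝ) × (ι → ℝ)), (∀ b ∈ B, ∀ i, b.1 i < b.2 i) ∧
        Q ∩ N ⊆ ⋃ b ∈ B, Set.Icc b.1 b.2 ∧ ⋃ b ∈ B, Set.Icc b.1 b.2 ⊆ Q)
    ⟨∅, by simp⟩
    (fun N N' hN ⟨B, h1, h2, h3⟩ =>
      ⟨B, h1, (Set.inter_subset_inter_right Q hN).trans h2, h3⟩)
    (fun N N' ⟨B, h1, h2, h3⟩ ⟨B', h1', h2', h3'⟩ => by
      refine ⟨B ∪ B', fun b hb => (Finset.mem_union.1 hb).elim (h1 b) (h1' b), ?_, ?_⟩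
      · rw [Finset.set_biUnion_union, Set.inter_union_distrib_left]
        exact Set.union_subset_union h2 h2'
      · rw [Finset.set_biUnion_union]
        exact Set.union_subset h3 h3')
    (fun y hy => by
      obtain ⟨S, hS⟩ := h y hy
      obtain ⟨N, hN, hB⟩ := exists_boxes_of_hasGerm hS
      exact ⟨N, mem_nhdsWithin_of_mem_nhds hN, hB⟩)
  rw [Set.inter_self] at h2
  exact ⟨B, h1, h2.antisymm h3⟩

/-! ### Forgetting coordinates -/

/-- Extension of a sign vector by `1`. -/
noncomputable def extend {C : Set ι} (t : C → ℤˣ) : ι → ℤˣ :=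
  fun i => if h : i ∈ C then t ⟨i, h⟩ else 1

theorem ReadOnce.preimage_extend {A C : Set ι} {S : Set (ι → ℤˣ)} (h : ReadOnce A S)
    (hAC : A ⊆ C) : ReadOnce ((↑) ⁻¹' A : Set C) (extend ⁻¹' S) := by
  induction h with
  | edge i e =>
    have hi : i ∈ C := hAC rfl
    convert ReadOnce.edge (⟨i, hi⟩ : C) e using 1
    · ext j
      simp [Subtype.ext_iff]
    · ext t
      simp [extend, hi]
  | compl _ ih => exact (ih hAC).compl
  | inter hd _ _ ih₁ ih₂ =>
    exact .inter (hd.preimage _) (ih₁ (Set.subset_union_left.trans hAC))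
      (ih₂ (Set.subset_union_right.trans hAC))

theorem Floral.preimage_extend {A C : Set ι} {S : Set (ι → ℤˣ)} (h : Floral A S)
    (hAC : A ⊆ C) : Floral ((↑) ⁻¹' A : Set C) (extend ⁻¹' S) := by
  rcases h with ⟨rfl, rfl⟩ | h
  · exact Or.inl ⟨rfl, rfl⟩
  · exact Or.inr (h.preimage_extend hAC)

theorem Floral.supportedOn {E : Set ι} {S : Set (ι → ℤˣ)} (h : Floral E S) :
    SupportedOn E S := by
  rcases h with ⟨-, rfl⟩ | h
  · exact fun _ _ _ => Iff.rfl
  · exact h.supportedOn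

theorem comp_val_mem_cone_iff {C : Set ι} {S : Set (ι → ℤˣ)} (hS : SupportedOn C S)
    (x : ι → ℝ) : (fun j : C => x j) ∈ cone (extend ⁻¹' S : Set (C → ℤˣ)) ↔ x ∈ cone S := by
  rw [mem_cone, mem_cone]
  constructor
  · rintro ⟨s, hs, h⟩
    refine ⟨C.piecewise (extend s) (signVec x), (hS _ _ fun i hi => by simp [hi]).1 hs,
      fun i hi => ?_⟩
    by_cases hC : i ∈ C
    · simp only [hC, Set.piecewise_eq_of_mem, extend, dif_pos]
      exact h ⟨i, hC⟩ hi
    · simp [hC]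
  · rintro ⟨s, hs, h⟩
    refine ⟨fun j => s j, (hS _ _ fun i hi => by simp [hi, extend]).1 hs, fun j hj => h j hj⟩

theorem IsGenericOrthotope.isGenericOrthotopeOfDim_closure [Fintype ι] {P : Set (ι → ℝ)}
    (hP : IsGenericOrthotope P) {v : ι → ℝ} (hv : v ∈ P) :
    IsGenericOrthotopeOfDim (degree (genericityRegion P v)) (closure (genericityRegion P v)) := by
  have hg := hP.1.hasGerms
  have hFP : closure (genericityRegion P v) ⊆ P :=
    closure_minimal (genericityRegion_subset P v) hP.1.isCompact.isClosed
  set E := essential (germ P v) with hE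
  set F := closure (genericityRegion P v) with hF
  have hFE : ∀ u ∈ F, ∀ i ∈ E, u i = v i := fun u hu =>
    eq_of_mem_closure_genericityRegion hg hu
  refine ⟨E, fun i => v i, (hg.degree_genericityRegion hv).symm, fun u hu i => hFE u hu i i.2, ?_⟩
  set π : (ι → ℝ) → ((Eᶜ : Set ι) → ℝ) := fun x j => x j with hπ
  have hπc : Continuous π := by fun_prop
  have hFc : IsCompact F := hP.1.isCompact.of_isClosed_subset isClosed_closure hFP
  have hQc : IsCompact (π '' F) := hFc.image hπc
  have hgerm : ∀ y ∈ π '' F, ∃ A S, Floral A S ∧ HasGerm (π '' F) y S := by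
    rintro _ ⟨u, hu, rfl⟩
    obtain ⟨D, hD⟩ := hP.exists_floral (hFP hu)
    obtain ⟨hG, hloc⟩ := hg.eventually_mem_closure_iff hu hD
    have hsub : D \ E ⊆ Eᶜ := fun i hi => hi.2
    refine ⟨_, _, hG.preimage_extend hsub, ?_⟩
    -- The inverse of `π` on the hyperplane containing `F`.
    let lift : ((Eᶜ : Set ι) → ℝ) → (ι → ℝ) := fun y i =>
      if h : i ∈ Eᶜ then y ⟨i, h⟩ else u i
    have hlift : Continuous lift := by
      refine continuous_pi fun i => ?_
      by_cases h : i ∈ Eᶜ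
      · simpa only [lift, h, dif_pos] using continuous_apply _
      · simpa only [lift, h, dif_neg, not_false_iff] using continuous_const
    have hπl : ∀ y, π (lift y) = y := by
      intro y
      ext j
      have := j.2
      simp only [π, lift, this, dif_pos]
    have hlπ : ∀ w ∈ F, lift (π w) = w := by
      intro w hw
      ext i
      by_cases h : i ∈ Eᶜ
      · simp only [π, lift, h, dif_pos]
      · simp only [lift, h, dif_neg, not_false_iff]
        rw [hFE u hu i (not_not.1 h), hFE w hw i (not_not.1 h)]
    have hmem : ∀ y, y ∈ π '' F ↔ lift y ∈ F := by
      intro y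
      constructor
      · rintro ⟨w, hw, rfl⟩
        rwa [hlπ w hw]
      · exact fun h => ⟨_, h, hπl y⟩
    have ht : Tendsto lift (𝓝 (π u)) (𝓝 u) := by
      have := hlift.tendsto (π u)
      rwa [hlπ u hu] at this
    filter_upwards [ht.eventually hloc] with y hy
    rw [hmem, hy, ← comp_val_mem_cone_iff (hG.supportedOn.mono hsub)]
    have e : (fun j : (Eᶜ : Set ι) => (lift y - u) j) = y - π u := by
      ext j
      exact congrFun (congrArg (· - π u) (hπl y)) j
    rw [e]
    refine and_iff_right fun i hi => ?_
    have : i ∉ Eᶜ := not_not.2 hi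
    simp only [lift, this, dif_neg, not_false_iff]
  have hpure : IsPureOrthogonalPolytope (π '' F) :=
    isPureOrthogonalPolytope_of_hasGerm hQc fun y hy =>
      let ⟨_, S, _, hS⟩ := hgerm y hy
      ⟨S, hS⟩
  refine ⟨hpure, fun y hy => ?_⟩
  obtain ⟨hyQ, hess⟩ := hpure.hasGerms.isSingularPoint_iff.1 hy
  obtain ⟨A, S, hA, hS⟩ := hgerm y hyQ
  rw [hS.germ_eq, hA.essential_eq] at hess
  subst hess
  exact ⟨cone S, isTangentCone_iff.2 ⟨S, rfl, hS⟩, isFloralArrangement_cone_iff.2 hA⟩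

end Orthotope

theorem mainTheorem7 (d k : ℕ) (P F : Set (Fin d → ℝ))
    (hP : Orthotope.IsGenericOrthotope P) (hF : Orthotope.IsFace P k F) :
    Orthotope.IsGenericOrthotopeOfDim k F := by
  obtain ⟨v, hv, rfl, rfl⟩ := hF
  exact hP.isGenericOrthotopeOfDim_closure hv
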